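/- Let $X$ be a smooth ($C^\infty$) manifold of dimension $nr$ and let $W=W(n+1,n,r)$ be an $(n+1)$-web on $X$: $n+1$ smooth foliations $\lambda_1,\dots,\lambda_{n+1}$ of codimension $r$ in general position (at every point the tangent spaces of any $n$ of them intersect in $0$ only). Let $1\le l<k<n$. *Adapted coframes and torsion.* An adapted coframe on an open set consists of smooth $\mathbb R^r$-valued 1-forms $\omega_\alpha=(\omega_\alpha^i)_{i=1}^r$, $\alpha=1,\dots,n$, such that $\lambda_\alpha$ is given by $\omega_\alpha=0$ and $\lambda_{n+1}$ is given by $\omega_1+\dots+\omega_n=0$. The torsion components $a_{\alpha\beta}{}^i_{jm}$ ($\alpha\ne\beta$) in such a coframe are the smooth functions which, together with some smooth 1-forms $\omega^i_j$, satisfy $$d\omega_\alpha^i=\sum_j\omega_\alpha^j\wedge\omega_j^i+\sum_{\beta\neq\alpha}\sum_{j,m}a_{\alpha\beta}{}^i_{jm}\,\omega_\alpha^j\wedge\omega_\beta^m,\qquad a_{\alpha\beta}{}^i_{jm}=a_{\beta\alpha}{}^i_{mj},\qquad \sum_{\alpha\ne\beta}a_{\alpha\beta}{}^i_{jm}=0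 .$$ *Closed form equations.* A closed form equation of $W$ on an open set $U\subset X$ is an equation $x_{n+1}=f(x_1,\dots,x_n)$ with $f$ smooth, where $x_\xi:U\to\mathbb R^r$ is a smooth submersion whose level sets are tangent to $\lambda_\xi$ ($\xi=1,\dots,n+1$) and $(x_1,\dots,x_n)$ is a coordinate system on $U$. **Theorem.** Every point of $X$ has a neighbourhood with an adapted coframe possessing torsion components, and a neighbourhood with a closed form equation of $W$. Moreover, the following four statements are equivalent. (i) All reduct $(k+1)$-subwebs $[n+1,1,\dots,k]$ of $W$ (the webs cut by $\lambda_1,\dots,\lambda_k,\lambda_{n+1}$ on the intersections of leaves of $\lambda_{k+1},\dots,\lambda_n$) are $(l+1,k)$-reducible: for every closed form equation of $W$ and every point of its domain, with $c_\sigma$ the value of $x_\sigma$ at this point ($\sigma=k+1,\dots,n$), there are smooth $\mathbb R^r$-valued functions $F_c$ and $g_c$ such that, near the point, $$f(x_1,\dots,x_k,c_{k+1},\dots,c_n)=F_c\bigl(x_1,\dots,x_l,\,g_c(x_{l+1},\dots,x_k)\bigr).$$ (ii) In every adapted coframe the torsion components satisfy $a_{pa}{}^i_{jm}=a_{pb}{}^i_{jm}$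 for all $p\in\{1,\dots,l\}$, all $a,b\in\{l+1,\dots,k\}$ and all $i,j,m$. (iii) For every adapted coframe, the distribution defined by the equations $$\omega_\sigma^i=0\ (\sigma=k+1,\dots,n),\qquad \omega_{l+1}^i+\omega_{l+2}^i+\dots+\omega_k^i=0,\qquad i=1,\dots,r,$$ is integrable, i.e. it is tangent to a smooth foliation (of codimension $(n-k+1)r$). (iv) The closed form equation of $W$ has the form $$x_{n+1}=F\bigl(x_1,\dots,x_l,\,g(x_{l+1},\dots,x_n),\,x_{k+1},\dots,x_n\bigr)$$ with smooth $\mathbb R^r$-valued functions $F$ and $g$, locally near every point of the domain of every closed form equation of $W$. -/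

import Mathlib

open scoped Manifold ContDiff Topology

/-- Vectors with `r` real components. -/
abbrev Vec (r : ℕ) : Type := EuclideanSpace ℝ (Fin r)

/-- A field of tangent subspaces on a manifold of dimension `N`. -/
abbrev TangentDistribution (N : ℕ) (X : Type*) [TopologicalSpace X] [ChartedSpace (Vec N) X] : Type _ :=
  ∀ q : X, Submodule ℝ (TangentSpace (𝓡 N) q)

/-- On the set `U`, the distribution `D` has codimension `m` and is completely integrable:
near every point of `U` it is the field of tangent spaces of the level sets of a smooth
submersion into `ℝ^m`, that is, it is tangent to a foliation of codimension `m`. -/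
def IsIntegrableOn {N : ℕ} {X : Type*} [TopologicalSpace X] [ChartedSpace (Vec N) X]
    (D : TangentDistribution N X) (m : ℕ) (U : Set X) : Prop :=
  ∀ q ∈ U, ∃ (O : Set X) (u : X → Vec m), IsOpen O ∧ q ∈ O ∧ ContMDiffOn (𝓡 N) (𝓡 m) ∞ u O ∧
    ∀ y ∈ O, Function.Surjective (mfderiv (𝓡 N) (𝓡 m) u y) ∧
      D y = LinearMap.ker (mfderiv (𝓡 N) (𝓡 m) u y).toLinearMap

/-- An `(n+1)`-web `W(n+1,n,r)` on a manifold of dimension `nr`: `n+1` smooth foliations of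
codimension `r`, given by their tangent distributions, in general position (the tangent spaces of
any `n` of them at a point meet in zero only, so that their `n` conormal spaces, each of dimension
`r`, form a direct sum). The foliations `0, …, n-1` and `Fin.last n` stand for
`λ_1, …, λ_n` and `λ_{n+1}`. -/
structure Web (n r : ℕ) (X : Type*) [TopologicalSpace X] [ChartedSpace (Vec (n * r)) X] where
  tangent : Fin (n + 1) → TangentDistribution (n * r) X
  foliation : ∀ ξ, IsIntegrableOn (tangent ξ) r Set.univ
  general_position : ∀ (η : Fin (n + 1)) (q : X),
    ⨅ (ξ : Fin (n + 1)) (_ : ξ ≠ η), tangent ξ q = ⊥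

/-- The exterior derivative of a vector-valued 1-form `φ` on a normed space, at `y`,
evaluated at `(u, v)`. -/
noncomputable def dForm {E F : Type*} [NormedAddCommGroup E] [NormedSpace ℝ E]
    [NormedAddCommGroup F] [NormedSpace ℝ F] (φ : E → E →L[ℝ] F) (y u v : E) : F :=
  extDeriv (fun z => ContinuousAlternatingMap.ofSubsingleton ℝ E F (0 : Fin 1) (φ z)) y ![u, v]

/-- The usual formula for `dForm`. -/
theorem dForm_eq {E F : Type*} [NormedAddCommGroup E] [NormedSpace ℝ E]
    [NormedAddCommGroup F] [NormedSpace ℝ F] (φ : E → E →L[ℝ] F) (y u v : E) :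
    dForm φ y u v = fderiv ℝ φ y u v - fderiv ℝ φ y v u := by
  let L := ContinuousAlternatingMap.ofSubsingletonLIE (𝕜 := ℝ) (E := E) (F := F) (0 : Fin 1)
  have e : fderiv ℝ (fun z => ContinuousAlternatingMap.ofSubsingleton ℝ E F (0 : Fin 1) (φ z)) y =
      (L.toContinuousLinearEquiv : (E →L[ℝ] F) →L[ℝ] _).comp (fderiv ℝ φ y) :=
    L.toContinuousLinearEquiv.comp_fderiv (f := φ)
  unfold dForm
  rw [extDeriv, e]
  simp [ContinuousAlternatingMap.alternatizeUncurryFin_apply, Fin.sum_univ_two, L, Fin.removeNth,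
    sub_eq_add_neg]

/-- The value at `(u, v)` of the wedge product of two linear forms. -/
def wedge {E : Type*} [AddCommGroup E] [Module ℝ E] [TopologicalSpace E]
    (φ ψ : E →L[ℝ] ℝ) (u v : E) : ℝ :=
  φ u * ψ v - φ v * ψ u

/-- The `i`-th component of a linear map with values in `ℝ^r`. -/
noncomputable def component {N r : ℕ} (φ : Vec N →L[ℝ] Vec r) (i : Fin r) : Vec N →L[ℝ] ℝ :=
  (EuclideanSpace.proj i : Vec r →L[ℝ] ℝ).comp φ

namespace Web

variable {n r : ℕ} {X : Type*} [TopologicalSpace X] [ChartedSpace (Vec (n * r)) X]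

/-- A local adapted coframe of the web: on the domain of a smooth chart, 1-forms
`ω_α = (ω_α^1, …, ω_α^r)`, `α = 1, …, n`, written in the coordinates of the chart, such that
`λ_α` is given by `ω_α = 0` and `λ_{n+1}` by `ω_{n+1} := -(ω_1 + … + ω_n) = 0`. By general position
the `nr` forms `ω_α^i` are then a basis of the cotangent space at each point. -/
structure AdaptedCoframe (W : Web n r X) where
  chart : OpenPartialHomeomorph X (Vec (n * r))
  chart_mem : chart ∈ IsManifold.maximalAtlas (𝓡 (n * r)) ∞ X
  coordForm : Fin n → Vec (n * r) → Vec (n * r) →L[ℝ] Vec r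
  smooth : ∀ α, ContDiffOn ℝ ∞ (coordForm α) chart.target
  ker_eq : ∀ q ∈ chart.source, ∀ α : Fin n, ∀ v : TangentSpace (𝓡 (n * r)) q,
    v ∈ W.tangent α.castSucc q ↔
      coordForm α (chart q) (mfderiv (𝓡 (n * r)) (𝓡 (n * r)) chart q v) = 0
  ker_last_eq : ∀ q ∈ chart.source, ∀ v : TangentSpace (𝓡 (n * r)) q,
    v ∈ W.tangent (Fin.last n) q ↔
      ∑ α, coordForm α (chart q) (mfderiv (𝓡 (n * r)) (𝓡 (n * r)) chart q v) = 0

namespace AdaptedCoframe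

variable {W : Web n r X}

/-- The 1-form `ω_α` on the manifold itself. -/
noncomputable def form (S : W.AdaptedCoframe) (α : Fin n) (q : X) :
    TangentSpace (𝓡 (n * r)) q →L[ℝ] Vec r :=
  (S.coordForm α (S.chart q)).comp (mfderiv (𝓡 (n * r)) (𝓡 (n * r)) S.chart q)

/-- The distribution `ω_σ = 0` for `k < σ ≤ n`, `ω_{l+1} + … + ω_k = 0`. -/
noncomputable def distribution (S : W.AdaptedCoframe) (l k : ℕ) : TangentDistribution (n * r) X :=
  fun q =>
    (⨅ (σ : Fin n) (_ : k ≤ σ.val), LinearMap.ker (S.form σ q).toLinearMap) ⊓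
      LinearMap.ker
        (∑ a : Fin n with l ≤ a.val ∧ a.val < k, S.form a q).toLinearMap

/-- The structure equations
`dω_α^i = ∑_j ω_α^j ∧ ω_j^i + ∑_{β ≠ α} ∑_{j,m} a_{αβ}^i_{jm} ω_α^j ∧ ω_β^m`
with connection forms `ω_j^i = θ i j`, subject to `a_{αβ}^i_{jm} = a_{βα}^i_{mj}` and
`∑_{α ≠ β} a_{αβ}^i_{jm} = 0`. Here `a α β i j m` stands for `a_{αβ}^i_{jm}` (`α ≠ β`): the
components of the torsion tensor of the web in the given coframe. -/
structure StructureEquations (S : W.AdaptedCoframe)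
    (θ : Fin r → Fin r → Vec (n * r) → Vec (n * r) →L[ℝ] ℝ)
    (a : Fin n → Fin n → Fin r → Fin r → Fin r → Vec (n * r) → ℝ) : Prop where
  smooth_conn : ∀ i j, ContDiffOn ℝ ∞ (θ i j) S.chart.target
  smooth_torsion : ∀ α β i j m, α ≠ β → ContDiffOn ℝ ∞ (a α β i j m) S.chart.target
  structure_eq : ∀ y ∈ S.chart.target, ∀ α i, ∀ u v : Vec (n * r),
    dForm (S.coordForm α) y u v i =
      ∑ j, wedge (component (S.coordForm α y) j) (θ i j y) u v +
      ∑ β : Fin n with β ≠ α, ∑ j, ∑ m,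
        a α β i j m y * wedge (component (S.coordForm α y) j) (component (S.coordForm β y) m) u v
  torsion_symm : ∀ y ∈ S.chart.target, ∀ α β i j m, α ≠ β → a α β i j m y = a β α i m j y
  torsion_sum : ∀ y ∈ S.chart.target, ∀ i j m,
    ∑ α : Fin n, ∑ β : Fin n with β ≠ α, a α β i j m y = 0

end AdaptedCoframe

/-- A closed form equation `x_{n+1} = f(x_1, …, x_n)` of the web on an open set `U`: the leaves
of `λ_ξ` are the level sets of `x_ξ : U → ℝ^r`, and `(x_1, …, x_n)` is a coordinate system on `U`.
The conditions `det (∂f/∂x_α) ≠ 0` hold because of general position. -/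
structure ClosedForm (W : Web n r X) where
  U : Set X
  isOpen : IsOpen U
  x : Fin (n + 1) → X → Vec r
  smooth : ∀ ξ, ContMDiffOn (𝓡 (n * r)) (𝓡 r) ∞ (x ξ) U
  surjective : ∀ ξ, ∀ q ∈ U, Function.Surjective (mfderiv (𝓡 (n * r)) (𝓡 r) (x ξ) q)
  ker_eq : ∀ ξ, ∀ q ∈ U,
    W.tangent ξ q = LinearMap.ker (mfderiv (𝓡 (n * r)) (𝓡 r) (x ξ) q).toLinearMap
  injOn : Set.InjOn (fun (q : X) (α : Fin n) => x α.castSucc q) U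
  isOpen_image : IsOpen ((fun (q : X) (α : Fin n) => x α.castSucc q) '' U)
  f : (Fin n → Vec r) → Vec r
  smooth_f : ContDiffOn ℝ ∞ f ((fun (q : X) (α : Fin n) => x α.castSucc q) '' U)
  eq : ∀ q ∈ U, x (Fin.last n) q = f (fun α => x α.castSucc q)

end Web

/-- `g` is smooth on a neighbourhood of `z`. -/
def SmoothNear {E F : Type*} [NormedAddCommGroup E] [NormedSpace ℝ E]
    [NormedAddCommGroup F] [NormedSpace ℝ F] (g : E → F) (z : E) : Prop :=
  ∃ O : Set E, IsOpen O ∧ z ∈ O ∧ ContDiffOn ℝ ∞ g O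

/-- Near `z`, the function `h` of `k` variables in `ℝ^r` has the form
`h(x_1, …, x_k) = F(x_1, …, x_l, g(x_{l+1}, …, x_k))` with smooth `ℝ^r`-valued `F` and `g`:
the `(k+1)`-web `x_{k+1} = h(x_1, …, x_k)` is `(l+1,k)`-reducible near `z`. -/
def ReducibleNear {k r : ℕ} (l : ℕ) (h : (Fin k → Vec r) → Vec r) (z : Fin k → Vec r) : Prop :=
  ∃ (g : ({a : Fin k // l ≤ a.val} → Vec r) → Vec r)
    (F : ({p : Fin k // p.val < l} → Vec r) × Vec r → Vec r),
    SmoothNear g (fun a => z a) ∧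
    SmoothNear F (fun p => z p, g (fun a => z a)) ∧
    ∀ᶠ w in 𝓝 z, h w = F (fun p => w p, g (fun a => w a))

/-- Near `z`, the function `h` of `n` variables in `ℝ^r` has the form
`h(x_1, …, x_n) = F(x_1, …, x_l, g(x_{l+1}, …, x_n), x_{k+1}, …, x_n)` with smooth
`ℝ^r`-valued `F` and `g`. -/
def ReductFormNear {n r : ℕ} (l k : ℕ) (h : (Fin n → Vec r) → Vec r) (z : Fin n → Vec r) : Prop :=
  ∃ (g : ({b : Fin n // l ≤ b.val} → Vec r) → Vec r)
    (F : ({p : Fin n // p.val < l} → Vec r) × Vec r × ({σ : Fin n // k ≤ σ.val} → Vec r) → Vec r),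
    SmoothNear g (fun b => z b) ∧
    SmoothNear F (fun p => z p, g (fun b => z b), fun σ => z σ) ∧
    ∀ᶠ w in 𝓝 z, h w = F (fun p => w p, g (fun b => w b), fun σ => w σ)

namespace Web

variable {n r : ℕ} {X : Type*} [TopologicalSpace X] [ChartedSpace (Vec (n * r)) X]

/-- The function `f(x_1, …, x_k, c_{k+1}, …, c_n)` of `x_1, …, x_k`, where `c_σ = x_σ(q)`. It gives
the closed form equation of the `(k+1)`-subweb `[n+1, 1, …, k]` cut on the intersection
`x_σ = c_σ` of the leaves through `q` of the foliations `λ_σ`, `σ = k+1, …, n`. -/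
def ClosedForm.reduct {W : Web n r X} (C : W.ClosedForm) (k : ℕ) (q : X) :
    (Fin k → Vec r) → Vec r :=
  fun w => C.f (fun α => if h : α.val < k then w ⟨α.val, h⟩ else C.x α.castSucc q)

/-- All reduct subwebs `[n+1, 1, …, k]` of the web are `(l+1,k)`-reducible (locally, in each closed
form equation of the web). -/
def HasReducibleReduct (W : Web n r X) (l k : ℕ) (hk : k < n) : Prop :=
  ∀ (C : W.ClosedForm), ∀ q ∈ C.U,
    ReducibleNear l (C.reduct k q) (fun t => C.x (Fin.castLE hk.le t).castSucc q)

/-- The components of the torsion tensor satisfy `a_{pa}^i_{jm} = a_{pb}^i_{jm}` for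
`p = 1, …, l` and `a, b = l+1, …, k`, in every adapted coframe. -/
def TorsionCondition (W : Web n r X) (l k : ℕ) : Prop :=
  ∀ (S : W.AdaptedCoframe) (θ : Fin r → Fin r → Vec (n * r) → Vec (n * r) →L[ℝ] ℝ)
    (t : Fin n → Fin n → Fin r → Fin r → Fin r → Vec (n * r) → ℝ), S.StructureEquations θ t →
    ∀ y ∈ S.chart.target, ∀ p a b : Fin n, p.val < l → l ≤ a.val → a.val < k →
      l ≤ b.val → b.val < k → ∀ i j m, t p a i j m y = t p b i j m y

/-- The distribution `ω_σ = 0` for `k < σ ≤ n`, `ω_{l+1} + … + ω_k = 0` is integrable. -/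
def DistributionIntegrable (W : Web n r X) (l k : ℕ) : Prop :=
  ∀ S : W.AdaptedCoframe, IsIntegrableOn (S.distribution l k) ((n - k + 1) * r) S.chart.source

/-- The closed form equation of the web has (locally) the form
`x_{n+1} = F(x_1, …, x_l, g(x_{l+1}, …, x_n), x_{k+1}, …, x_n)`. -/
def HasReductClosedForm (W : Web n r X) (l k : ℕ) : Prop :=
  ∀ (C : W.ClosedForm), ∀ q ∈ C.U, ReductFormNear l k C.f (fun α => C.x α.castSucc q)

end Web

/-! All four statements amount to one pointwise condition on a closed form equation, `InfReducible`:
if v lies in the block of x_{l+1}, …, x_k and df(v) = 0, then D²f(e, v) = 0 for all e in the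
directions x_1, …, x_l. Thus the kernel of df on the block does not turn, to first order, as x_1, …,
x_l vary.

Torsion: by general position an adapted coframe is ω_α = A (∂f/∂x_α) dx_α with a single invertible A
(`exists_common_factor`). On the dual frame e_α the structure equations give a_{pa}(U, V) = -B(V, U)
- A D²f(e_p U, e_a V). The symmetries of the torsion and of D²f, together with a third index, make B
independent of p and a. So a_{pa} = a_{pb} means D²f(e_p U, e_a V - e_b V) = 0, and these
differences span the kernel of df on the block (`torsion_eq_iff_infReducible`).

Necessity: the directions x_1, …, x_l lie in the distribution of (iii), so a submersion defining it
is constant along them and its kernel is carried along unchanged (`infReducible_of_reductVectors`).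
If the reduct has the form F(x_1, …, x_l, g), the kernel of df on the block is that of dg, where
x_1, …, x_l do not occur (`infReducible_of_reducibleNear`).

Sufficiency: the infinitesimal condition integrates, so the kernel on the block is constant along
x_1, …, x_l (`fderiv_eq_zero_of_infReducible`). Let g be f with x_1, …, x_l frozen, and use g as a
coordinate in place of x_k; then f no longer depends on x_{l+1}, …, x_{k-1}, which is (iv)
(`reductFormNear_of_infReducible`). Freezing x_{k+1}, …, x_n in (iv) gives (i), and the submersion
(g, x_{k+1}, …, x_n) gives (iii). -/

/-! ### Derivatives along lines -/

/-- A function whose derivative in the direction `b - a` vanishes on a convex set takes the same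
value at `a` and `b`. -/
theorem eq_of_fderiv_sub_eq_zero {E F : Type*} [NormedAddCommGroup E] [NormedSpace ℝ E]
    [NormedAddCommGroup F] [NormedSpace ℝ F] {s : Set E} (hs : Convex ℝ s) {h : E → F}
    (hd : ∀ x ∈ s, DifferentiableAt ℝ h x) {a b : E} (ha : a ∈ s) (hb : b ∈ s)
    (h0 : ∀ x ∈ s, fderiv ℝ h x (b - a) = 0) : h a = h b := by
  have key : ∀ t ∈ Set.Icc (0 : ℝ) 1,
      HasDerivAt (fun t : ℝ => h (AffineMap.lineMap a b t)) 0 t := by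
    intro t ht
    have hx : AffineMap.lineMap a b t ∈ s := hs.lineMap_mem ha hb ht
    have := (hd _ hx).hasFDerivAt.comp_hasDerivAt t (AffineMap.hasDerivAt_lineMap (a := a) (b := b))
    rwa [h0 _ hx] at this
  have := constant_of_has_deriv_right_zero (a := (0 : ℝ)) (b := 1)
    (f := fun t : ℝ => h (AffineMap.lineMap a b t))
    (fun t ht => (key t ht).continuousAt.continuousWithinAt)
    (fun t ht => (key t ⟨ht.1, ht.2.le⟩).hasDerivWithinAt) 1 (by simp)
  simpa using this.symm

theorem hasDerivAt_comp_line {E F : Type*} [NormedAddCommGroup E] [NormedSpace ℝ E]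
    [NormedAddCommGroup F] [NormedSpace ℝ F] {h : E → F} {z : E} (hd : DifferentiableAt ℝ h z)
    (e : E) : HasDerivAt (fun t : ℝ => h (z + t • e)) (fderiv ℝ h z e) 0 := by
  have h1 : HasDerivAt (fun t : ℝ => z + t • e) e 0 := by
    simpa using ((hasDerivAt_id (0 : ℝ)).smul_const e).const_add z
  have h2 : HasFDerivAt h (fderiv ℝ h z) (z + (0 : ℝ) • e) := by simpa using hd.hasFDerivAt
  exact h2.comp_hasDerivAt (0 : ℝ) h1

theorem tendsto_add_smul {E : Type*} [NormedAddCommGroup E] [NormedSpace ℝ E] (z e : E) :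
    Filter.Tendsto (fun t : ℝ => z + t • e) (𝓝 0) (𝓝 z) := by
  have : Continuous (fun t : ℝ => z + t • e) := by fun_prop
  simpa using this.tendsto 0

theorem fderiv_fderiv_eq_zero_of_eventually {E F : Type*} [NormedAddCommGroup E] [NormedSpace ℝ E]
    [NormedAddCommGroup F] [NormedSpace ℝ F] {f : E → F} {z : E}
    (hd : DifferentiableAt ℝ (fderiv ℝ f) z) {e v : E}
    (h : ∀ᶠ t in 𝓝 (0 : ℝ), fderiv ℝ f (z + t • e) v = 0) : fderiv ℝ (fderiv ℝ f) z e v = 0 := by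
  have h1 : HasDerivAt (fun t : ℝ => fderiv ℝ f (z + t • e) v) (fderiv ℝ (fderiv ℝ f) z e v) 0 :=
    (hasDerivAt_comp_line hd e).clm_apply (hasDerivAt_const (0 : ℝ) v) |>.congr_deriv (by simp)
  have h2 : HasDerivAt (fun t : ℝ => fderiv ℝ f (z + t • e) v) 0 0 :=
    (hasDerivAt_const (0 : ℝ) (0 : F)).congr_of_eventuallyEq h
  exact h1.unique h2

/-- On a ball where Du(e) = 0 the function u is invariant under small translations along e;
differentiating this invariance gives the same invariance for Du. -/
theorem eventually_fderiv_add_smul_eq {E G : Type*} [NormedAddCommGroup E] [NormedSpace ℝ E]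
    [NormedAddCommGroup G] [NormedSpace ℝ G] {u : E → G} {z e : E}
    (h : ∀ᶠ x in 𝓝 z, DifferentiableAt ℝ u x ∧ fderiv ℝ u x e = 0) :
    ∀ᶠ t in 𝓝 (0 : ℝ), fderiv ℝ u (z + t • e) = fderiv ℝ u z := by
  obtain ⟨ε, hε, hB⟩ := Metric.eventually_nhds_iff_ball.1 h
  filter_upwards [(tendsto_add_smul z e).eventually (Metric.ball_mem_nhds z hε)] with t ht
  have heq : (fun x => u (x + t • e)) =ᶠ[𝓝 z] u := by
    have h1 : ∀ᶠ x in 𝓝 z, x + t • e ∈ Metric.ball z ε :=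
      (by fun_prop : Continuous fun x => x + t • e).continuousAt (Metric.isOpen_ball.mem_nhds ht)
    filter_upwards [h1, Metric.ball_mem_nhds z hε] with x hx hx'
    refine (eq_of_fderiv_sub_eq_zero (convex_ball z ε) (fun y hy => (hB y hy).1) hx' hx ?_).symm
    intro y hy
    rw [add_sub_cancel_left, map_smul, (hB y hy).2, smul_zero]
  rw [← fderiv_comp_add_right, heq.fderiv_eq]

theorem ContDiffAt.differentiableAt_fderiv {E F : Type*} [NormedAddCommGroup E] [NormedSpace ℝ E]
    [NormedAddCommGroup F] [NormedSpace ℝ F] {f : E → F} {z : E} (h : ContDiffAt ℝ ∞ f z) :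
    DifferentiableAt ℝ (fderiv ℝ f) z :=
  (h.fderiv_right (m := ∞) (by simp)).differentiableAt (by simp)

theorem SmoothNear.contDiffAt {E F : Type*} [NormedAddCommGroup E] [NormedSpace ℝ E]
    [NormedAddCommGroup F] [NormedSpace ℝ F] {g : E → F} {z : E} (h : SmoothNear g z) :
    ContDiffAt ℝ ∞ g z := by
  obtain ⟨O, hO, hz, hg⟩ := h
  exact hg.contDiffAt (hO.mem_nhds hz)

theorem SmoothNear.eventually {E F : Type*} [NormedAddCommGroup E] [NormedSpace ℝ E]
    [NormedAddCommGroup F] [NormedSpace ℝ F] {g : E → F} {z : E} (h : SmoothNear g z) :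
    ∀ᶠ x in 𝓝 z, ContDiffAt ℝ ∞ g x := by
  obtain ⟨O, hO, hz, hg⟩ := h
  filter_upwards [hO.mem_nhds hz] with x hx using hg.contDiffAt (hO.mem_nhds hx)

theorem smoothNear_of_eventually {E F : Type*} [NormedAddCommGroup E] [NormedSpace ℝ E]
    [NormedAddCommGroup F] [NormedSpace ℝ F] {g : E → F} {z : E}
    (h : ∀ᶠ x in 𝓝 z, ContDiffAt ℝ ∞ g x) : SmoothNear g z := by
  obtain ⟨O, hO, hO', hz⟩ := eventually_nhds_iff.1 h
  exact ⟨O, hO', hz, fun x hx => (hO x hx).contDiffWithinAt⟩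

/-! ### The infinitesimal condition and integrable distributions -/

/-- The partial derivatives `∂f/∂x_α` of `f` at `w` are injective. -/
def PartialsInjective {n r : ℕ} (f : (Fin n → Vec r) → Vec r) (w : Fin n → Vec r) : Prop :=
  ∀ α, Function.Injective (fun s : Vec r => fderiv ℝ f w (Pi.single α s))

/-- The infinitesimal form of reducibility at `w`: the kernel of `∑ (∂f/∂x_a) dx_a`,
`l ≤ a < k`, is stationary in the directions `x_p`, `p < l`. -/
def InfReducible {n r : ℕ} (l k : ℕ) (f : (Fin n → Vec r) → Vec r) (w : Fin n → Vec r) : Prop :=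
  ∀ e v : Fin n → Vec r, (∀ α : Fin n, l ≤ α.val → e α = 0) →
    (∀ α : Fin n, ¬ (l ≤ α.val ∧ α.val < k) → v α = 0) → fderiv ℝ f w v = 0 →
    fderiv ℝ (fderiv ℝ f) w e v = 0

/-- The projection which keeps the components `a` with `l ≤ a < k`. -/
noncomputable def band (n r l k : ℕ) : (Fin n → Vec r) →L[ℝ] (Fin n → Vec r) :=
  ContinuousLinearMap.pi fun α =>
    (if l ≤ α.val ∧ α.val < k then (1 : ℝ) else 0) • ContinuousLinearMap.proj α

theorem band_apply {n r : ℕ} (l k : ℕ) (v : Fin n → Vec r) (α : Fin n) :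
    band n r l k v α = if l ≤ α.val ∧ α.val < k then v α else 0 := by
  change (if l ≤ α.val ∧ α.val < k then (1 : ℝ) else 0) • v α = _
  rw [ite_smul, one_smul, zero_smul]

theorem band_eq_self {n r l k : ℕ} {v : Fin n → Vec r}
    (hv : ∀ α : Fin n, ¬ (l ≤ α.val ∧ α.val < k) → v α = 0) : band n r l k v = v := by
  ext1 α
  rw [band_apply]
  split_ifs with h
  · rfl
  · exact (hv α h).symm

/-- The vectors of the distribution `dx_σ = 0` for `σ ≥ k`, `∑ (∂f/∂x_a) dx_a = 0` for
`l ≤ a < k`. -/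
def ReductVector {n r : ℕ} (l k : ℕ) (f : (Fin n → Vec r) → Vec r) (w v : Fin n → Vec r) : Prop :=
  (∀ σ : Fin n, k ≤ σ.val → v σ = 0) ∧ fderiv ℝ f w (band n r l k v) = 0

/-- The directions with indices below `l` satisfy the equations of the distribution, so u is
constant along them and Du is the same at all points z + t e. A kernel vector v at z therefore stays
in the distribution along this line, where Df(v) = 0; the derivative at t = 0 is the claim. -/
theorem infReducible_of_reductVectors {n r l k : ℕ} (hlk : l < k) {G : Type*}
    [NormedAddCommGroup G] [NormedSpace ℝ G] {f : (Fin n → Vec r) → Vec r} {z : Fin n → Vec r}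
    {u : (Fin n → Vec r) → G} (hf : ContDiffAt ℝ ∞ f z) (hu : ∀ᶠ w in 𝓝 z, DifferentiableAt ℝ u w)
    (h : ∀ᶠ w in 𝓝 z, ∀ v, fderiv ℝ u w v = 0 ↔ ReductVector l k f w v) :
    InfReducible l k f z := by
  intro e v he hv h0
  have hev : ∀ w, (∀ v, fderiv ℝ u w v = 0 ↔ ReductVector l k f w v) → fderiv ℝ u w e = 0 := by
    intro w hw
    refine (hw e).2 ⟨fun σ hσ => he σ (by omega), ?_⟩
    have : band n r l k e = 0 := by
      ext1 α
      rw [band_apply]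
      split_ifs with h
      · exact he α h.1
      · rfl
    simp [this]
  have hvz : fderiv ℝ u z v = 0 := by
    refine (h.self_of_nhds v).2 ⟨fun σ hσ => hv σ (by omega), ?_⟩
    rwa [band_eq_self hv]
  refine fderiv_fderiv_eq_zero_of_eventually hf.differentiableAt_fderiv ?_
  have h1 := eventually_fderiv_add_smul_eq (hu.and (h.mono hev))
  filter_upwards [h1, (tendsto_add_smul z e).eventually h] with t ht ht'
  have h3 := ((ht' v).1 (by rw [ht, hvz])).2
  rwa [band_eq_self hv] at h3

/-! ### Consequences of reducibility -/

/-- The restriction of a family indexed by `Fin n` to the indices satisfying `P`. -/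
noncomputable def restrictCoord {n : ℕ} (r : ℕ) (P : Fin n → Prop) :
    (Fin n → Vec r) →L[ℝ] ({a : Fin n // P a} → Vec r) :=
  ContinuousLinearMap.pi fun a => ContinuousLinearMap.proj a.1

/-- An injective endomorphism of ℝ^r is surjective, so A is surjective and hence injective. This is
applied with A the derivative of F in the slot of g, through which a partial derivative of f
factors. -/
theorem injective_of_comp_injective {r : ℕ} {M : Type*} [AddCommGroup M] [Module ℝ M]
    (A : Vec r →ₗ[ℝ] Vec r) (B : M →ₗ[ℝ] Vec r) (C : Vec r →ₗ[ℝ] M)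
    (h : Function.Injective (A ∘ₗ B ∘ₗ C)) : Function.Injective A := by
  have : Function.Surjective (A ∘ₗ B ∘ₗ C) := LinearMap.injective_iff_surjective.1 h
  refine LinearMap.injective_iff_surjective.2 fun y => ?_
  obtain ⟨x, hx⟩ := this y
  exact ⟨B (C x), hx⟩

/-- On the block Df = A ∘ Dg, where only the factor A, the derivative of F in its last slot, depends
on the variables below `l`. Since A is injective at z, Df(v) = 0 forces Dg(v) = 0, and then Df(v) =
0 along the whole line z + t e. -/
theorem infReducible_of_reducibleNear {n r l k : ℕ} (hlk : l < k) (hkn : k ≤ n)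
    {f : (Fin n → Vec r) → Vec r} {z : Fin n → Vec r} (hf : SmoothNear f z)
    (hinj : PartialsInjective f z)
    (h : ReducibleNear l
      (fun w : Fin k → Vec r => f (fun α => if h : α.val < k then w ⟨α.val, h⟩ else z α))
      (fun t => z (Fin.castLE hkn t))) : InfReducible l k f z := by
  obtain ⟨g, F, hg, hF, heq⟩ := h
  let R : (Fin n → Vec r) →L[ℝ] (Fin k → Vec r) :=
    ContinuousLinearMap.pi fun t => ContinuousLinearMap.proj (Fin.castLE hkn t)
  let p := (restrictCoord r fun a : Fin k => a.val < l) ∘L R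
  let q := (restrictCoord r fun a : Fin k => l ≤ a.val) ∘L R
  have hF' : SmoothNear F (p z, g (q z)) := hF
  have hg' : SmoothNear g (q z) := hg
  have heq' : ∀ᶠ w in 𝓝 z, (∀ σ : Fin n, k ≤ σ.val → w σ = z σ) → f w = F (p w, g (q w)) := by
    have hR : Filter.Tendsto R (𝓝 z) (𝓝 (R z)) := R.continuous.tendsto z
    filter_upwards [hR.eventually heq] with w hw hσ
    have e1 : (fun α : Fin n => if h : α.val < k then R w ⟨α.val, h⟩ else z α) = w := by
      ext1 α
      split_ifs with h
      · rfl
      · exact (hσ α (by omega)).symm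
    rw [e1] at hw
    exact hw
  -- the derivative of `f` along vectors supported in `[l, k)`
  have key : ∀ e v : Fin n → Vec r, (∀ α : Fin n, l ≤ α.val → e α = 0) →
      (∀ α : Fin n, ¬ (l ≤ α.val ∧ α.val < k) → v α = 0) → ∀ᶠ t in 𝓝 (0 : ℝ),
      fderiv ℝ f (z + t • e) v = fderiv ℝ F (p z + t • p e, g (q z)) (0, fderiv ℝ g (q z) (q v)) := by
    intro e v he hv
    have hpv : p v = 0 := by
      ext1 a
      exact hv _ fun h => absurd h.1 (not_le.2 a.2)
    have hqe : q e = 0 := by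
      ext1 a
      exact he _ a.2
    have hT : Filter.Tendsto (fun ts : ℝ × ℝ => z + ts.1 • e + ts.2 • v) (𝓝 0 ×ˢ 𝓝 0) (𝓝 z) := by
      rw [← nhds_prod_eq]
      have : Continuous (fun ts : ℝ × ℝ => z + ts.1 • e + ts.2 • v) := by fun_prop
      simpa using this.tendsto (0, 0)
    have hFd : ∀ᶠ t in 𝓝 (0 : ℝ), DifferentiableAt ℝ F (p z + t • p e, g (q z)) := by
      have : Continuous (fun t : ℝ => (p z + t • p e, g (q z))) := by fun_prop
      have h := this.tendsto 0
      simp only [zero_smul, add_zero] at h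
      filter_upwards [h.eventually hF'.eventually] with t ht using ht.differentiableAt (by simp)
    have hfd : ∀ᶠ t in 𝓝 (0 : ℝ), DifferentiableAt ℝ f (z + t • e) := by
      filter_upwards [(tendsto_add_smul z e).eventually hf.eventually] with t ht
        using ht.differentiableAt (by simp)
    -- The factorization holds for (t, s) near (0, 0); currying gives, for each small t, its
    -- validity for all small s, so that the derivative in s can be taken with t fixed.
    filter_upwards [(hT.eventually heq').curry, hFd, hfd] with t ht hFt hft
    have h1 := hasDerivAt_comp_line hft v
    have h2 : HasDerivAt (fun s : ℝ => F (p z + t • p e, g (q z + s • q v)))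
        (fderiv ℝ F (p z + t • p e, g (q z)) (0, fderiv ℝ g (q z) (q v))) 0 := by
      have h3 := (hasDerivAt_const (0 : ℝ) (p z + t • p e)).prodMk
        (hasDerivAt_comp_line (hg'.contDiffAt.differentiableAt (by simp)) (q v))
      have h4 : HasFDerivAt F (fderiv ℝ F (p z + t • p e, g (q z)))
          (p z + t • p e, g (q z + (0 : ℝ) • q v)) := by simpa using hFt.hasFDerivAt
      exact h4.comp_hasDerivAt (0 : ℝ) h3
    refine h1.unique (h2.congr_of_eventuallyEq ?_)
    filter_upwards [ht] with s hs
    rw [hs]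
    · simp [hpv, hqe]
    · intro σ hσ
      simp [he σ (by omega), hv σ (by omega)]
  let A : Vec r →ₗ[ℝ] Vec r :=
    (fderiv ℝ F (p z, g (q z))).toLinearMap ∘ₗ LinearMap.inr ℝ _ _
  have hA : Function.Injective A := by
    refine injective_of_comp_injective A ((fderiv ℝ g (q z)).toLinearMap ∘ₗ q.toLinearMap)
      (LinearMap.single ℝ (fun _ : Fin n => Vec r) ⟨l, by omega⟩) ?_
    intro s s' hs
    refine hinj ⟨l, by omega⟩ ?_
    have h1 : ∀ s : Vec r, fderiv ℝ f z (Pi.single ⟨l, by omega⟩ s) =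
        A (fderiv ℝ g (q z) (q (Pi.single ⟨l, by omega⟩ s))) := by
      intro s
      have := (key 0 (Pi.single ⟨l, by omega⟩ s) (by simp) (by
        intro α hα
        refine Pi.single_eq_of_ne ?_ _
        rintro rfl
        exact hα ⟨le_rfl, hlk⟩)).self_of_nhds
      simp only [zero_smul, add_zero] at this
      exact this
    simp only [h1]
    exact hs
  intro e v he hv h0
  have hz := (key 0 v (by simp) hv).self_of_nhds
  simp only [zero_smul, add_zero, h0] at hz
  have h1 : fderiv ℝ g (q z) (q v) = 0 := hA (hz.symm.trans (map_zero A).symm)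
  refine fderiv_fderiv_eq_zero_of_eventually hf.contDiffAt.differentiableAt_fderiv ?_
  filter_upwards [key e v he hv] with t ht
  rw [ht, h1]
  exact map_zero (fderiv ℝ F (p z + t • p e, g (q z)))

theorem reducibleNear_of_reductFormNear {n r l k : ℕ} (hkn : k ≤ n)
    {f : (Fin n → Vec r) → Vec r} {z : Fin n → Vec r} (h : ReductFormNear l k f z) :
    ReducibleNear l
      (fun w : Fin k → Vec r => f (fun α => if h : α.val < k then w ⟨α.val, h⟩ else z α))
      (fun t => z (Fin.castLE hkn t)) := by
  obtain ⟨g, F, hg, hF, heq⟩ := h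
  let J : ({a : Fin k // l ≤ a.val} → Vec r) → ({b : Fin n // l ≤ b.val} → Vec r) :=
    fun y b => if h : b.1.val < k then y ⟨⟨b.1.val, h⟩, b.2⟩ else z b.1
  -- When `l ≤ k` the second branch is never reached, since p < l; it only makes the map total.
  let K : ({p : Fin k // p.val < l} → Vec r) → ({p : Fin n // p.val < l} → Vec r) :=
    fun y p => if h : p.1.val < k then y ⟨⟨p.1.val, h⟩, p.2⟩ else z p.1
  let I : (Fin k → Vec r) → (Fin n → Vec r) :=
    fun w α => if h : α.val < k then w ⟨α.val, h⟩ else z α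
  have hJ : ContDiff ℝ ∞ J := by
    refine contDiff_pi.2 fun b => ?_
    by_cases h : b.1.val < k
    · simpa [J, h] using contDiff_apply ℝ (Vec r) _
    · simpa [J, h] using contDiff_const
  have hK : ContDiff ℝ ∞ K := by
    refine contDiff_pi.2 fun b => ?_
    by_cases h : b.1.val < k
    · simpa [K, h] using contDiff_apply ℝ (Vec r) _
    · simpa [K, h] using contDiff_const
  have hI : Continuous I := by
    refine continuous_pi fun b => ?_
    by_cases h : b.val < k
    · simpa [I, h] using continuous_apply _
    · simpa [I, h] using continuous_const
  have hJz : J (fun a => z (Fin.castLE hkn a.1)) = fun b => z b.1 := by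
    ext1 b
    by_cases h : b.1.val < k <;> simp [J, h]
  have hKz : K (fun a => z (Fin.castLE hkn a.1)) = fun b => z b.1 := by
    ext1 b
    by_cases h : b.1.val < k <;> simp [K, h]
  have hIz : I (fun a => z (Fin.castLE hkn a)) = z := by
    ext1 b
    by_cases h : b.val < k <;> simp [I, h]
  refine ⟨fun y => g (J y), fun y => F (K y.1, y.2, fun σ => z σ.1), ?_, ?_, ?_⟩
  · refine smoothNear_of_eventually ?_
    have h1 := hg.eventually
    rw [← hJz] at h1
    filter_upwards [hJ.continuous.continuousAt.eventually h1] with y hy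
    exact hy.comp y hJ.contDiffAt
  · refine smoothNear_of_eventually ?_
    have hc : ContDiff ℝ ∞ fun y : ({p : Fin k // p.val < l} → Vec r) × Vec r =>
        (K y.1, y.2, fun σ : {σ : Fin n // k ≤ σ.val} => z σ.1) :=
      (hK.comp contDiff_fst).prodMk (contDiff_snd.prodMk contDiff_const)
    have h1 := hF.eventually
    rw [← hJz, ← hKz] at h1
    have h2 := hc.continuous.tendsto ((fun p => z (Fin.castLE hkn p.1)),
      g (J fun a => z (Fin.castLE hkn a.1)))
    filter_upwards [h2.eventually h1] with y hy
    exact hy.comp y hc.contDiffAt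
  · have h1 := hI.tendsto (fun a => z (Fin.castLE hkn a))
    rw [hIz] at h1
    filter_upwards [h1.eventually heq] with w hw
    have e1 : (fun σ : {σ : Fin n // k ≤ σ.val} => I w σ.1) = fun σ => z σ.1 := by
      ext1 σ
      have := σ.2
      simp [I, not_lt.2 this]
    rw [e1] at hw
    exact hw

/-- The submersion is (g, x_{k+1}, …, x_n). On the block Df = A ∘ Dg with A injective, so Dg and Df
have the same kernel there; the injective composite also makes ∂g/∂x_{l+1} invertible, which gives
surjectivity. -/
theorem exists_submersion_of_reductFormNear {n r l k : ℕ} (hlk : l < k) (hkn : k < n)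
    {f : (Fin n → Vec r) → Vec r} {z : Fin n → Vec r}
    (hinj : ∀ᶠ w in 𝓝 z, PartialsInjective f w) (h : ReductFormNear l k f z) :
    ∃ (u : (Fin n → Vec r) → Vec ((n - k + 1) * r)) (O : Set (Fin n → Vec r)),
      IsOpen O ∧ z ∈ O ∧ ContDiffOn ℝ ∞ u O ∧
      ∀ w ∈ O, Function.Surjective (fderiv ℝ u w) ∧
        ∀ v, fderiv ℝ u w v = 0 ↔ ReductVector l k f w v := by
  obtain ⟨g, F, hg, hF, heq⟩ := h
  let p := restrictCoord r fun a : Fin n => a.val < l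
  let q := restrictCoord r fun a : Fin n => l ≤ a.val
  let s := restrictCoord r fun a : Fin n => k ≤ a.val
  have hg' : SmoothNear g (q z) := hg
  have hF' : SmoothNear F (p z, g (q z), s z) := hF
  have heq' : ∀ᶠ w in 𝓝 z, f w = F (p w, g (q w), s w) := heq
  have hcard : Module.finrank ℝ (Vec r × ({σ : Fin n // k ≤ σ.val} → Vec r)) =
      Module.finrank ℝ (Vec ((n - k + 1) * r)) := by
    have h1 : Fintype.card {σ : Fin n // k ≤ σ.val} = n - k := by
      have h2 : Fintype.card {σ : Fin n // ¬ k ≤ σ.val} = k := by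
        have e : {σ : Fin n // ¬ k ≤ σ.val} ≃ Fin k :=
          { toFun := fun σ => ⟨σ.1.val, not_le.1 σ.2⟩
            invFun := fun t => ⟨⟨t.val, by omega⟩, not_le.2 t.2⟩
            left_inv := fun _ => rfl
            right_inv := fun _ => rfl }
        rw [Fintype.card_congr e, Fintype.card_fin]
      have h3 := Fintype.card_subtype_compl fun σ : Fin n => k ≤ σ.val
      have h4 := Fintype.card_subtype_le fun σ : Fin n => k ≤ σ.val
      rw [h2, Fintype.card_fin] at h3
      rw [Fintype.card_fin] at h4
      omega
    rw [Module.finrank_prod, Module.finrank_pi_fintype]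
    simp only [finrank_euclideanSpace, Fintype.card_fin, Finset.sum_const, Finset.card_univ, h1,
      smul_eq_mul]
    ring
  let T := ContinuousLinearEquiv.ofFinrankEq hcard
  let u : (Fin n → Vec r) → Vec ((n - k + 1) * r) := fun w => T (g (q w), s w)
  have hev : ∀ᶠ w in 𝓝 z, (∀ᶠ w' in 𝓝 w, f w' = F (p w', g (q w'), s w')) ∧
      PartialsInjective f w ∧ ContDiffAt ℝ ∞ g (q w) ∧ ContDiffAt ℝ ∞ F (p w, g (q w), s w) := by
    have h1 : ContinuousAt (fun w => (p w, g (q w), s w)) z := by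
      have : ContinuousAt g (q z) := hg'.contDiffAt.continuousAt
      exact p.continuous.continuousAt.prodMk
        ((this.comp q.continuous.continuousAt).prodMk s.continuous.continuousAt)
    exact heq'.eventually_nhds.and (hinj.and
      ((q.continuous.continuousAt.eventually hg'.eventually).and (h1.eventually hF'.eventually)))
  obtain ⟨O, hO, hOo, hzO⟩ := eventually_nhds_iff.1 hev
  have hus : ∀ w ∈ O, ContDiffAt ℝ ∞ u w := fun w hw =>
    T.contDiff.contDiffAt.comp w
      (((hO w hw).2.2.1.comp w q.contDiff.contDiffAt).prodMk s.contDiff.contDiffAt)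
  refine ⟨u, O, hOo, hzO, fun w hw => (hus w hw).contDiffWithinAt, fun w hw => ?_⟩
  obtain ⟨hfF, hi, hgw, hFw⟩ := hO w hw
  have hgd : HasFDerivAt (fun w => g (q w)) ((fderiv ℝ g (q w)) ∘L q) w :=
    (hgw.differentiableAt (by simp)).hasFDerivAt.comp w q.hasFDerivAt
  have hud : fderiv ℝ u w =
      (T : _ →L[ℝ] Vec ((n - k + 1) * r)) ∘L (((fderiv ℝ g (q w)) ∘L q).prod s) :=
    (T.hasFDerivAt.comp w (hgd.prodMk s.hasFDerivAt)).fderiv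
  have hud' : ∀ v, fderiv ℝ u w v = T (fderiv ℝ g (q w) (q v), s v) := fun v => by
    rw [hud]
    rfl
  have hfd : ∀ v, fderiv ℝ f w v =
      fderiv ℝ F (p w, g (q w), s w) (p v, fderiv ℝ g (q w) (q v), s v) := fun v => by
    have h1 : HasFDerivAt (fun w => F (p w, g (q w), s w)) _ w :=
      (hFw.differentiableAt (by simp)).hasFDerivAt.comp w
        (p.hasFDerivAt.prodMk (hgd.prodMk s.hasFDerivAt))
    rw [Filter.EventuallyEq.fderiv_eq hfF, h1.fderiv]
    rfl
  let A : Vec r →ₗ[ℝ] Vec r := (fderiv ℝ F (p w, g (q w), s w)).toLinearMap ∘ₗ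
    LinearMap.inr ℝ _ _ ∘ₗ LinearMap.inl ℝ _ _
  have hfA : ∀ v : Fin n → Vec r, (∀ α : Fin n, ¬ (l ≤ α.val ∧ α.val < k) → v α = 0) →
      fderiv ℝ f w v = A (fderiv ℝ g (q w) (q v)) := by
    intro v hv
    have hp : p v = 0 := by
      ext1 a
      exact hv _ fun h => absurd h.1 (not_le.2 a.2)
    have hs : s v = 0 := by
      ext1 a
      exact hv _ fun h => absurd h.2 (not_lt.2 a.2)
    rw [hfd, hp, hs]
    rfl
  let B : Vec r →ₗ[ℝ] Vec r := (fderiv ℝ g (q w)).toLinearMap ∘ₗ q.toLinearMap ∘ₗ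
      LinearMap.single ℝ (fun _ : Fin n => Vec r) ⟨l, by omega⟩
  have hsingle : ∀ x : Vec r, ∀ α : Fin n, ¬ (l ≤ α.val ∧ α.val < k) →
      (Pi.single (⟨l, by omega⟩ : Fin n) x : Fin n → Vec r) α = 0 := by
    intro x α hα
    refine Pi.single_eq_of_ne ?_ _
    rintro rfl
    exact hα ⟨le_rfl, hlk⟩
  have hAB : Function.Injective (A ∘ₗ B) := by
    intro x x' hx
    refine hi ⟨l, by omega⟩ ?_
    change fderiv ℝ f w (Pi.single _ x) = fderiv ℝ f w (Pi.single _ x')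
    rw [hfA _ (hsingle x), hfA _ (hsingle x')]
    exact hx
  have hA : Function.Injective A := injective_of_comp_injective A B LinearMap.id hAB
  have hB : Function.Surjective B :=
    LinearMap.injective_iff_surjective.1 (Function.Injective.of_comp (f := A) hAB)
  constructor
  · intro y
    -- The last components are prescribed first; the value of Dg is then corrected in the direction
    -- x_{l+1}, which leaves them unchanged.
    let τ := (T.symm y).2
    let v₀ : Fin n → Vec r := fun α => if h : k ≤ α.val then τ ⟨α, h⟩ else 0
    obtain ⟨x, hx⟩ := hB ((T.symm y).1 - fderiv ℝ g (q w) (q v₀))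
    refine ⟨v₀ + Pi.single ⟨l, by omega⟩ x, ?_⟩
    have h1 : s (v₀ + Pi.single ⟨l, by omega⟩ x) = τ := by
      ext1 σ
      change v₀ σ.1 + (Pi.single (⟨l, by omega⟩ : Fin n) x : Fin n → Vec r) σ.1 = _
      rw [hsingle x σ.1 (fun h => absurd h.2 (not_lt.2 σ.2)), add_zero]
      exact dif_pos σ.2
    have h2 : fderiv ℝ g (q w) (q (v₀ + Pi.single ⟨l, by omega⟩ x)) = (T.symm y).1 := by
      rw [map_add, map_add]
      change _ + B x = _
      rw [hx]
      abel
    rw [hud', h1, h2]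
    exact T.apply_symm_apply y
  · intro v
    rw [hud', T.map_eq_zero_iff, Prod.mk_eq_zero, and_comm]
    have hs : s v = 0 ↔ ∀ σ : Fin n, k ≤ σ.val → v σ = 0 :=
      ⟨fun h σ hσ => congrFun h ⟨σ, hσ⟩, fun h => funext fun σ => h σ.1 σ.2⟩
    rw [hs]
    refine and_congr_right fun hσ => ?_
    have hband : ∀ α : Fin n, ¬ (l ≤ α.val ∧ α.val < k) → band n r l k v α = 0 := by
      intro α hα
      rw [band_apply, if_neg hα]
    have hq : q (band n r l k v) = q v := by
      ext1 b
      change band n r l k v b.1 = v b.1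
      rw [band_apply]
      split_ifs with h
      · rfl
      · have := b.2
        exact (hσ b.1 (by omega)).symm
    rw [hfA _ hband, hq]
    exact ⟨fun h => by rw [h, map_zero], fun h => hA (h.trans (map_zero A).symm)⟩

/-! ### From the infinitesimal condition to the normal form -/

/-- With P = ∂f/∂x_{l+1}, put N = P⁻¹ Df(v), so that v - N, with N placed in slot l+1, always lies
in the kernel of Df on the block. Differentiating Df(v - N) = 0 along w' - w, the term with D²f
vanishes by hypothesis and P(DN(w' - w)) = 0 remains. Hence N takes the same value at w and w', and
N(w) = 0. -/
theorem fderiv_eq_zero_of_infReducible {n r l k : ℕ} (hlk : l < k) (hkn : k < n)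
    {f : (Fin n → Vec r) → Vec r} {s : Set (Fin n → Vec r)} (hs : Convex ℝ s)
    (hso : IsOpen s)
    (hf : ∀ w ∈ s, ContDiffAt ℝ ∞ f w) (hinj : ∀ w ∈ s, PartialsInjective f w)
    (hred : ∀ w ∈ s, InfReducible l k f w) {w w' : Fin n → Vec r} (hw : w ∈ s) (hw' : w' ∈ s)
    (hww : ∀ α : Fin n, l ≤ α.val → w α = w' α) {v : Fin n → Vec r}
    (hv : ∀ α : Fin n, ¬ (l ≤ α.val ∧ α.val < k) → v α = 0) (h0 : fderiv ℝ f w v = 0) :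
    fderiv ℝ f w' v = 0 := by
  let J : Vec r →L[ℝ] (Fin n → Vec r) :=
    ContinuousLinearMap.single ℝ (fun _ : Fin n => Vec r) ⟨l, by omega⟩
  have hsingle : ∀ x : Vec r, ∀ α : Fin n, ¬ (l ≤ α.val ∧ α.val < k) → J x α = 0 := by
    intro x α hα
    refine Pi.single_eq_of_ne ?_ _
    rintro rfl
    exact hα ⟨le_rfl, hlk⟩
  let P : (Fin n → Vec r) → Vec r →L[ℝ] Vec r := fun x => (fderiv ℝ f x) ∘L J
  have hPi : ∀ x ∈ s, (P x).IsInvertible := fun x hx =>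
    ⟨(LinearEquiv.ofInjectiveEndo (P x).toLinearMap (hinj x hx _)).toContinuousLinearEquiv, by
      ext1 y; rfl⟩
  let N : (Fin n → Vec r) → Vec r := fun x => (P x).inverse (fderiv ℝ f x v)
  have hfd : ∀ x ∈ s, DifferentiableAt ℝ (fderiv ℝ f) x := fun x hx =>
    (hf x hx).differentiableAt_fderiv
  have hPd : ∀ x ∈ s, DifferentiableAt ℝ P x := fun x hx =>
    (hfd x hx).clm_comp (differentiableAt_const J)
  have hNd : ∀ x ∈ s, DifferentiableAt ℝ N x := fun x hx => by
    have h1 : DifferentiableAt ℝ (fun x => (P x).inverse) x :=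
      ((hPi x hx).contDiffAt_map_inverse (n := 1)).differentiableAt (by simp) |>.comp x (hPd x hx)
    exact h1.clm_apply ((hfd x hx).clm_apply (differentiableAt_const v))
  have hPN : ∀ x ∈ s, fderiv ℝ f x (J (N x)) = fderiv ℝ f x v := fun x hx =>
    (hPi x hx).self_apply_inverse (fderiv ℝ f x v)
  have hN : ∀ x ∈ s, fderiv ℝ N x (w' - w) = 0 := by
    intro x hx
    set e := w' - w with he
    have h1 : HasDerivAt (fun t : ℝ => fderiv ℝ f (x + t • e) (v - J (N (x + t • e))))
        (fderiv ℝ (fderiv ℝ f) x e (v - J (N x)) - fderiv ℝ f x (J (fderiv ℝ N x e))) 0 := by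
      have h2 := (hasDerivAt_comp_line (hfd x hx) e).clm_apply
        ((J.hasFDerivAt.comp_hasDerivAt (0 : ℝ) (hasDerivAt_comp_line (hNd x hx) e)).const_sub v)
      refine h2.congr_deriv ?_
      simp only [zero_smul, add_zero, map_neg, Function.comp_apply, sub_eq_add_neg]
    have h3 : HasDerivAt (fun t : ℝ => fderiv ℝ f (x + t • e) (v - J (N (x + t • e)))) 0 0 := by
      refine (hasDerivAt_const (0 : ℝ) (0 : Vec r)).congr_of_eventuallyEq ?_
      filter_upwards [(tendsto_add_smul x e).eventually (hso.mem_nhds hx)] with t ht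
      rw [map_sub, hPN _ ht, sub_self]
    have h4 : fderiv ℝ (fderiv ℝ f) x e (v - J (N x)) = 0 := by
      refine hred x hx e _ (fun α hα => ?_) (fun α hα => ?_) ?_
      · rw [he, Pi.sub_apply, hww α hα, sub_self]
      · rw [Pi.sub_apply, hv α hα, hsingle _ α hα, sub_zero]
      · rw [map_sub, hPN x hx, sub_self]
    have h5 := h1.unique h3
    rw [h4, zero_sub, neg_eq_zero] at h5
    exact hinj x hx _ (h5.trans ((congrArg _ (map_zero J)).trans (map_zero _)).symm)
  have hNeq : N w = N w' := eq_of_fderiv_sub_eq_zero hs hNd hw hw' hN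
  have : N w' = 0 := by
    rw [← hNeq]
    simp [N, h0]
  rw [← hPN w' hw', this, map_zero, map_zero]

/-- The inverse function theorem, restricted to a set where the derivative is everywhere injective,
so that the inverse is smooth on the whole target and not only at the image of z. -/
theorem exists_local_inverse {E F : Type*} [NormedAddCommGroup E] [NormedSpace ℝ E]
    [FiniteDimensional ℝ E] [NormedAddCommGroup F] [NormedSpace ℝ F] [FiniteDimensional ℝ F]
    (hEF : Module.finrank ℝ E = Module.finrank ℝ F) {Ψ : E → F} {U : Set E} (hU : IsOpen U)
    (hΨ : ContDiffOn ℝ ∞ Ψ U) (hinj : ∀ w ∈ U, Function.Injective (fderiv ℝ Ψ w)) {z : E}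
    (hz : z ∈ U) : ∃ Θ : OpenPartialHomeomorph E F, z ∈ Θ.source ∧ Θ.source ⊆ U ∧
      (∀ w, Θ w = Ψ w) ∧ ContDiffOn ℝ ∞ Θ.symm Θ.target := by
  have : CompleteSpace E := FiniteDimensional.complete ℝ E
  have hd : ∀ w ∈ U, ∃ e : E ≃L[ℝ] F, HasFDerivAt Ψ (e : E →L[ℝ] F) w := fun w hw => by
    refine ⟨(LinearEquiv.ofInjectiveOfFinrankEq (fderiv ℝ Ψ w).toLinearMap
      (hinj w hw) hEF).toContinuousLinearEquiv, ?_⟩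
    have := ((hΨ.contDiffAt (hU.mem_nhds hw)).differentiableAt (by simp)).hasFDerivAt
    refine this.congr_fderiv ?_
    ext1 v
    rfl
  obtain ⟨e, he⟩ := hd z hz
  let Θ₀ := (hΨ.contDiffAt (hU.mem_nhds hz)).toOpenPartialHomeomorph Ψ he (by simp)
  refine ⟨Θ₀.restrOpen U hU, ⟨?_, hz⟩, fun w hw => hw.2, fun w => rfl, fun y hy => ?_⟩
  · exact ContDiffAt.mem_toOpenPartialHomeomorph_source _ he (by simp)
  · have hyU : (Θ₀.restrOpen U hU).symm y ∈ U := ((Θ₀.restrOpen U hU).map_target hy).2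
    obtain ⟨e', he'⟩ := hd _ hyU
    exact ((Θ₀.restrOpen U hU).contDiffAt_symm hy he'
      (hΨ.contDiffAt (hU.mem_nhds hyU))).contDiffWithinAt

/-- The function g is f with the variables below `l` frozen at z. In coordinates where g replaces
the last variable of the block, f is independent of the other block variables: directions killing dg
also kill df at the unfrozen point. -/
theorem reductFormNear_of_infReducible {n r l k : ℕ} (hlk : l < k) (hkn : k < n)
    {f : (Fin n → Vec r) → Vec r} {z : Fin n → Vec r}
    (h : ∀ᶠ w in 𝓝 z, ContDiffAt ℝ ∞ f w ∧ PartialsInjective f w ∧ InfReducible l k f w) :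
    ReductFormNear l k f z := by
  obtain ⟨ε, hε, hB⟩ := Metric.eventually_nhds_iff_ball.1 h
  -- The zero-based index of x_k; taking the last index leaves the interval [l, k - 1) as the rest
  -- of the block.
  let κ : Fin n := ⟨k - 1, by omega⟩
  have hκ : κ.val = k - 1 := rfl
  let M' : (Fin n → Vec r) →L[ℝ] (Fin n → Vec r) := band n r l n
  -- `M` freezes the coordinates below `l` at their values in z, so g is `f ∘ M`; in the sup norm it
  -- preserves balls about z.
  let M : (Fin n → Vec r) → (Fin n → Vec r) :=
    fun w => M' w + fun α => if l ≤ α.val then 0 else z α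
  have hMα : ∀ w α, M w α = if l ≤ α.val then w α else z α := by
    intro w α
    change band n r l n w α + (if l ≤ α.val then 0 else z α) = _
    rw [band_apply]
    by_cases h : l ≤ α.val <;> simp [h]
  have hM : ∀ w, HasFDerivAt M M' w := fun w => M'.hasFDerivAt.add_const _
  have hMs : ContDiff ℝ ∞ M := M'.contDiff.add contDiff_const
  have hMz : M z = z := by
    ext1 α
    simp [hMα]
  have hMB : ∀ w ∈ Metric.ball z ε, M w ∈ Metric.ball z ε := by
    intro w hw
    rw [Metric.mem_ball, dist_pi_lt_iff hε] at hw ⊢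
    intro α
    by_cases hα : l ≤ α.val
    · simpa [hMα, hα] using hw α
    · simpa [hMα, hα] using hε
  let Ψ : (Fin n → Vec r) → (Fin n → Vec r) := fun w α => if α = κ then f (M w) else w α
  have hΨs : ContDiffOn ℝ ∞ Ψ (Metric.ball z ε) := by
    refine contDiffOn_pi.2 fun α => ?_
    by_cases hα : α = κ
    · simp only [Ψ, hα, if_true]
      exact fun w hw => ((hB _ (hMB w hw)).1.comp w hMs.contDiffAt).contDiffWithinAt
    · simp only [Ψ, hα, if_false]
      exact (contDiff_apply ℝ (Vec r) α).contDiffOn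
  have hΨd : ∀ w ∈ Metric.ball z ε, ∀ v, (∀ α, α ≠ κ → fderiv ℝ Ψ w v α = v α) ∧
      fderiv ℝ Ψ w v κ = fderiv ℝ f (M w) (M' v) := by
    intro w hw v
    have hd : DifferentiableAt ℝ Ψ w :=
      (hΨs.contDiffAt (Metric.isOpen_ball.mem_nhds hw)).differentiableAt (by simp)
    have hα : ∀ α, HasFDerivAt (fun w => Ψ w α)
        ((ContinuousLinearMap.proj α : (Fin n → Vec r) →L[ℝ] Vec r) ∘L fderiv ℝ Ψ w) w :=
      fun α => hasFDerivAt_pi'.1 hd.hasFDerivAt α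
    constructor
    · intro α hne
      have h1 := hα α
      simp only [Ψ, hne, if_false] at h1
      exact congrArg (fun L : (Fin n → Vec r) →L[ℝ] Vec r => L v) (h1.unique (hasFDerivAt_apply α w))
    · have h1 := hα κ
      simp only [Ψ, if_true] at h1
      have h2 : HasFDerivAt (fun w => f (M w)) ((fderiv ℝ f (M w)) ∘L M') w :=
        ((hB _ (hMB w hw)).1.differentiableAt (by simp)).hasFDerivAt.comp w (hM w)
      exact congrArg (fun L : (Fin n → Vec r) →L[ℝ] Vec r => L v) (h1.unique h2)
  have hM'v : ∀ v : Fin n → Vec r, (∀ α : Fin n, α.val < l → v α = 0) → M' v = v := by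
    intro v hv
    exact band_eq_self fun α hα => hv α (by have := α.2; omega)
  have hΨi : ∀ w ∈ Metric.ball z ε, Function.Injective (fderiv ℝ Ψ w) := by
    intro w hw
    refine (injective_iff_map_eq_zero _).2 fun v hv => ?_
    obtain ⟨h1, h2⟩ := hΨd w hw v
    rw [hv] at h1 h2
    have hvs : v = Pi.single κ (v κ) := by
      ext1 α
      by_cases hα : α = κ
      · subst hα
        simp
      · rw [Pi.single_eq_of_ne hα, ← h1 α hα]
        rfl
    have h3 : M' v = v := hM'v v fun α hα => (h1 α (by
      rintro rfl
      omega)).symm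
    rw [h3] at h2
    have h4 : v κ = 0 := by
      refine (hB _ (hMB w hw)).2.1 κ ?_
      change fderiv ℝ f (M w) (Pi.single κ (v κ)) = fderiv ℝ f (M w) (Pi.single κ 0)
      rw [← hvs, Pi.single_zero, map_zero, ← h2]
      rfl
    rw [hvs, h4, Pi.single_zero]
  obtain ⟨Θ, hzΘ, hΘU, hΘ, hΘs⟩ := exists_local_inverse rfl Metric.isOpen_ball hΨs hΨi
    (Metric.mem_ball_self hε)
  -- A ball inside the target supplies the convexity needed to join two points by a segment.
  obtain ⟨δ, hδ, hδB⟩ := Metric.isOpen_iff.1 Θ.open_target (Ψ z) (by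
    rw [← hΘ]
    exact Θ.map_source hzΘ)
  have hhs : ∀ y ∈ Θ.target, ContDiffAt ℝ ∞ (fun y => f (Θ.symm y)) y := fun y hy =>
    (hB _ (hΘU (Θ.map_target hy))).1.comp y (hΘs.contDiffAt (Θ.open_target.mem_nhds hy))
  -- Pulled back by Ψ, such a direction lies in the block and has Df = 0 at the frozen point `M w`;
  -- the preceding constancy lemma transports this to w.
  have hh0 : ∀ y ∈ Θ.target, ∀ v : Fin n → Vec r,
      (∀ α : Fin n, ¬ (l ≤ α.val ∧ α.val < k - 1) → v α = 0) →
      fderiv ℝ (fun y => f (Θ.symm y)) y v = 0 := by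
    intro y hy v hv
    have hw := hΘU (Θ.map_target hy)
    have hsd : DifferentiableAt ℝ Θ.symm y :=
      (hΘs.contDiffAt (Θ.open_target.mem_nhds hy)).differentiableAt (by simp)
    have hfd := (hB _ hw).1.differentiableAt (by simp)
    have e1 : fderiv ℝ (fun y => f (Θ.symm y)) y =
        fderiv ℝ f (Θ.symm y) ∘L fderiv ℝ Θ.symm y := fderiv_comp y hfd hsd
    have hΨfd : DifferentiableAt ℝ Ψ (Θ.symm y) :=
      (hΨs.contDiffAt (Metric.isOpen_ball.mem_nhds hw)).differentiableAt (by simp)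
    have e2 : fderiv ℝ Ψ (Θ.symm y) (fderiv ℝ Θ.symm y v) = v := by
      have h1 : HasFDerivAt (fun y => Ψ (Θ.symm y))
        (fderiv ℝ Ψ (Θ.symm y) ∘L fderiv ℝ Θ.symm y) y :=
        hΨfd.hasFDerivAt.comp y hsd.hasFDerivAt
      have h2 : (fun y => Ψ (Θ.symm y)) =ᶠ[𝓝 y] id := by
        filter_upwards [Θ.open_target.mem_nhds hy] with y' hy'
        rw [← hΘ]
        exact Θ.right_inv hy'
      exact congrArg (fun L : (Fin n → Vec r) →L[ℝ] (Fin n → Vec r) => L v)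
        (h1.unique ((hasFDerivAt_id y).congr_of_eventuallyEq h2))
    obtain ⟨h1, h2⟩ := hΨd _ hw (fderiv ℝ Θ.symm y v)
    rw [e2] at h1 h2
    have hv' : ∀ α : Fin n, ¬ (l ≤ α.val ∧ α.val < k) → fderiv ℝ Θ.symm y v α = 0 := by
      intro α hα
      rw [← h1 α (by
        rintro rfl
        omega)]
      exact hv α (by omega)
    rw [hM'v _ (fun α hα => hv' α (by omega)), hv κ (by omega)] at h2
    rw [e1]
    refine fderiv_eq_zero_of_infReducible hlk hkn (convex_ball z ε) Metric.isOpen_ball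
      (fun w hw => (hB w hw).1) (fun w hw => (hB w hw).2.1) (fun w hw => (hB w hw).2.2)
      (hMB _ hw) hw (fun α hα => ?_) hv' h2.symm
    simp [hMα, hα]
  -- This rebuilds a point in the new coordinates from (x_p), g and (x_σ). The missing coordinates
  -- in [l, k - 1) are taken from z, which is harmless because f does not depend on them.
  let asm : ({p : Fin n // p.val < l} → Vec r) × Vec r × ({σ : Fin n // k ≤ σ.val} → Vec r) →
      (Fin n → Vec r) := fun x α =>
    if h : α.val < l then x.1 ⟨α, h⟩ else if α = κ then x.2.1 else
      if h : k ≤ α.val then x.2.2 ⟨α, h⟩ else z α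
  have hasm : ContDiff ℝ ∞ asm := by
    refine contDiff_pi.2 fun α => ?_
    by_cases h : α.val < l
    · simp only [asm, h, dif_pos]
      exact (contDiff_apply ℝ (Vec r) _).comp contDiff_fst
    by_cases h' : α = κ
    · have : ¬ κ.val < l := h' ▸ h
      simp only [asm, h', this, dif_neg, not_false_eq_true, if_true]
      exact contDiff_fst.comp contDiff_snd
    by_cases h'' : k ≤ α.val
    · simp only [asm, h, h', h'', dif_neg, not_false_eq_true, if_false, dif_pos]
      exact (contDiff_apply ℝ (Vec r) _).comp (contDiff_snd.comp contDiff_snd)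
    · simpa [asm, h, h', h''] using contDiff_const
  let J : ({b : Fin n // l ≤ b.val} → Vec r) → (Fin n → Vec r) :=
    fun y α => if h : l ≤ α.val then y ⟨α, h⟩ else z α
  have hJ : ContDiff ℝ ∞ J := by
    refine contDiff_pi.2 fun α => ?_
    by_cases h : l ≤ α.val
    · simpa [J, h] using contDiff_apply ℝ (Vec r) _
    · simpa [J, h] using contDiff_const
  have hJM : ∀ w : Fin n → Vec r, J (fun b => w b.1) = M w := by
    intro w
    ext1 α
    by_cases h : l ≤ α.val <;> simp [J, hMα, h]
  have hasmz : asm (fun p => z p.1, f (M z), fun σ => z σ.1) = Ψ z := by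
    ext1 α
    by_cases h : α.val < l
    · have : α ≠ κ := by
        rintro rfl
        omega
      simp [asm, Ψ, h, this]
    by_cases h' : α = κ
    · have : ¬ κ.val < l := h' ▸ h
      simp [asm, Ψ, h', this]
    · simp [asm, Ψ, h, h']
  refine ⟨fun y => f (J y), fun x => f (Θ.symm (asm x)), ?_, ?_, ?_⟩
  · refine smoothNear_of_eventually ?_
    have h1 : J (fun b => z b.1) ∈ Metric.ball z ε := by
      rw [hJM, hMz]
      exact Metric.mem_ball_self hε
    filter_upwards [hJ.continuous.continuousAt.eventually (Metric.isOpen_ball.mem_nhds h1)]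
      with y hy
    exact (hB _ hy).1.comp y hJ.contDiffAt
  · refine smoothNear_of_eventually ?_
    have h1 : asm (fun p => z p.1, f (J fun b => z b.1), fun σ => z σ.1) ∈ Θ.target := by
      rw [hJM, hasmz]
      exact hδB (Metric.mem_ball_self hδ)
    filter_upwards [hasm.continuous.continuousAt.eventually (Θ.open_target.mem_nhds h1)]
      with y hy
    exact (hhs _ hy).comp y hasm.contDiffAt
  · have hΨc : ContinuousAt Ψ z :=
      (hΨs.contDiffAt (Metric.ball_mem_nhds z hε)).continuousAt
    have hac : ContinuousAt (fun w : Fin n → Vec r =>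
        asm (fun p => w p.1, f (M w), fun σ => w σ.1)) z := by
      have h1 : ContinuousAt (fun w => f (M w)) z :=
        ((hB _ (hMB z (Metric.mem_ball_self hε))).1.comp z hMs.contDiffAt).continuousAt
      refine hasm.continuous.continuousAt.comp ?_
      exact (restrictCoord r fun a : Fin n => a.val < l).continuous.continuousAt.prodMk
        (h1.prodMk (restrictCoord r fun a : Fin n => k ≤ a.val).continuous.continuousAt)
    have h2 : ∀ᶠ w in 𝓝 z, asm (fun p => w p.1, f (M w), fun σ => w σ.1) ∈ Metric.ball (Ψ z) δ := by
      refine hac.eventually (Metric.isOpen_ball.mem_nhds ?_)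
      change asm (fun p => z p.1, f (M z), fun σ => z σ.1) ∈ _
      rw [hasmz]
      exact Metric.mem_ball_self hδ
    filter_upwards [Θ.open_source.mem_nhds hzΘ, h2, hΨc.eventually (Metric.ball_mem_nhds _ hδ)] with w hw hw2 hw3
    rw [hJM]
    have h3 : f w = f (Θ.symm (Ψ w)) := by rw [← hΘ, Θ.left_inv hw]
    rw [h3]
    refine eq_of_fderiv_sub_eq_zero (h := fun y => f (Θ.symm y)) (convex_ball (Ψ z) δ)
      (fun y hy => (hhs y (hδB hy)).differentiableAt (by simp)) hw3 hw2 fun y hy =>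
        hh0 y (hδB hy) _ fun α hα => ?_
    rw [Pi.sub_apply, sub_eq_zero]
    by_cases h : α.val < l
    · have : α ≠ κ := by
        rintro rfl
        omega
      simp [asm, Ψ, h, this]
    by_cases h' : α = κ
    · have : ¬ κ.val < l := h' ▸ h
      simp [asm, Ψ, h', this]
    · have : k ≤ α.val := by
        have : α.val ≠ k - 1 := fun hh => h' (Fin.ext hh)
        omega
      simp [asm, Ψ, h, h', this]

/-! ### Torsion and the second derivative of f -/

theorem ContDiffAt.fderiv_fderiv_comm {E F : Type*} [NormedAddCommGroup E] [NormedSpace ℝ E]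
    [NormedAddCommGroup F] [NormedSpace ℝ F] {f : E → F} {z : E} (h : ContDiffAt ℝ ∞ f z)
    (u v : E) : fderiv ℝ (fderiv ℝ f) z u v = fderiv ℝ (fderiv ℝ f) z v u :=
  (h.isSymmSndFDerivAt (by
    rw [minSmoothness_of_isRCLikeNormedField]
    exact WithTop.coe_le_coe.2 (le_top (a := (2 : ℕ∞))))).eq u v

/-- The terms containing the second derivative of χ cancel by its symmetry. -/
theorem dForm_pullback {E E' F : Type*} [NormedAddCommGroup E] [NormedSpace ℝ E]
    [NormedAddCommGroup E'] [NormedSpace ℝ E'] [NormedAddCommGroup F] [NormedSpace ℝ F]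
    {χ : E → E'} {η : E' → E' →L[ℝ] F} {y : E} (hχ : ContDiffAt ℝ ∞ χ y)
    (hω : DifferentiableAt ℝ η (χ y)) (u v : E) :
    dForm (fun y => (η (χ y)) ∘L fderiv ℝ χ y) y u v =
      dForm η (χ y) (fderiv ℝ χ y u) (fderiv ℝ χ y v) := by
  have h1 : HasFDerivAt (fun y => η (χ y)) ((fderiv ℝ η (χ y)) ∘L fderiv ℝ χ y) y :=
    hω.hasFDerivAt.comp y (hχ.differentiableAt (by simp)).hasFDerivAt
  have h2 := h1.clm_comp hχ.differentiableAt_fderiv.hasFDerivAt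
  rw [dForm_eq, dForm_eq, h2.fderiv]
  simp [hχ.fderiv_fderiv_comm u v]

theorem clm_isInvertible_of_injective {r : ℕ} {P : Vec r →L[ℝ] Vec r}
    (h : Function.Injective P) : P.IsInvertible :=
  ⟨(LinearEquiv.ofInjectiveEndo P.toLinearMap h).toContinuousLinearEquiv, by ext1 y; rfl⟩

/-- The partial derivative `∂f/∂x_α`. -/
noncomputable def partialDeriv {n r : ℕ} (f : (Fin n → Vec r) → Vec r) (α : Fin n)
    (w : Fin n → Vec r) : Vec r →L[ℝ] Vec r :=
  (fderiv ℝ f w) ∘L ContinuousLinearMap.single ℝ (fun _ : Fin n => Vec r) α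

theorem partialDeriv_apply {n r : ℕ} (f : (Fin n → Vec r) → Vec r) (α : Fin n)
    (w : Fin n → Vec r) (s : Vec r) : partialDeriv f α w s = fderiv ℝ f w (Pi.single α s) := rfl

theorem PartialsInjective.isInvertible {n r : ℕ} {f : (Fin n → Vec r) → Vec r}
    {w : Fin n → Vec r} (h : PartialsInjective f w) (α : Fin n) :
    (partialDeriv f α w).IsInvertible :=
  clm_isInvertible_of_injective (h α)

theorem sum_fderiv_single {n r : ℕ} {G : Type*} [AddCommGroup G] [Module ℝ G] [TopologicalSpace G]
    (D : (Fin n → Vec r) →L[ℝ] G) (v : Fin n → Vec r) : ∑ α, D (Pi.single α (v α)) = D v := by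
  rw [← map_sum, Finset.univ_sum_single]

/-- The structure equations at a point of `(ℝ^r)^n`. -/
def StructureAt {n r : ℕ} (η : Fin n → (Fin n → Vec r) → (Fin n → Vec r) →L[ℝ] Vec r)
    (θ : Fin r → Fin r → (Fin n → Vec r) → ℝ) (t : Fin n → Fin n → Fin r → Fin r → Fin r → ℝ)
    (z : Fin n → Vec r) : Prop :=
  ∀ α i u v, dForm (η α) z u v i =
    ∑ j, (η α z u j * θ i j v - η α z v j * θ i j u) +
    ∑ β : Fin n with β ≠ α, ∑ j, ∑ m,
      t α β i j m * (η α z u j * η β z v m - η α z v j * η β z u m)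

/-- The pointwise factor is forced to be η_{α₀} composed with (∂f/∂x_{α₀})⁻¹, and so inherits
differentiability. -/
theorem exists_differentiable_factor {n r : ℕ} (α₀ : Fin n) {f : (Fin n → Vec r) → Vec r}
    {z : Fin n → Vec r} {η : Fin n → (Fin n → Vec r) → (Fin n → Vec r) →L[ℝ] Vec r}
    (hf : SmoothNear f z) (hinj : ∀ᶠ w in 𝓝 z, PartialsInjective f w)
    (hω : ∀ α, DifferentiableAt ℝ (η α) z)
    (hA : ∀ᶠ w in 𝓝 z, ∃ A : Vec r →L[ℝ] Vec r, Function.Injective A ∧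
      ∀ α v, η α w v = A (fderiv ℝ f w (Pi.single α (v α)))) :
    ∃ A : (Fin n → Vec r) → Vec r →L[ℝ] Vec r, DifferentiableAt ℝ A z ∧
      Function.Injective (A z) ∧
      ∀ᶠ w in 𝓝 z, ∀ α v, η α w v = A w (fderiv ℝ f w (Pi.single α (v α))) := by
  let J := ContinuousLinearMap.single ℝ (fun _ : Fin n => Vec r) α₀
  let A : (Fin n → Vec r) → Vec r →L[ℝ] Vec r := fun w =>
    (η α₀ w ∘L J) ∘L (partialDeriv f α₀ w).inverse
  have hAeq : ∀ᶠ w in 𝓝 z, Function.Injective (A w) ∧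
      ∀ α v, η α w v = A w (fderiv ℝ f w (Pi.single α (v α))) := by
    filter_upwards [hA, hinj] with w ⟨A', hA'i, hA'⟩ hw
    have : A w = A' := by
      ext1 s
      change η α₀ w (J ((partialDeriv f α₀ w).inverse s)) = A' s
      rw [hA']
      change A' (fderiv ℝ f w (Pi.single α₀
        ((Pi.single α₀ ((partialDeriv f α₀ w).inverse s) : Fin n → Vec r) α₀))) = A' s
      rw [Pi.single_eq_same, ← partialDeriv_apply, (hw.isInvertible α₀).self_apply_inverse]
    rw [this]
    exact ⟨hA'i, hA'⟩
  refine ⟨A, ?_, hAeq.self_of_nhds.1, hAeq.mono fun w hw => hw.2⟩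
  have h1 : DifferentiableAt ℝ (partialDeriv f α₀) z :=
    hf.contDiffAt.differentiableAt_fderiv.clm_comp (differentiableAt_const J)
  have h2 : DifferentiableAt ℝ (fun w => (partialDeriv f α₀ w).inverse) z :=
    ((hinj.self_of_nhds.isInvertible α₀).contDiffAt_map_inverse (n := 1)).differentiableAt
      (by simp) |>.comp z h1
  exact ((hω α₀).clm_comp (differentiableAt_const J)).clm_comp h2

/-- Evaluated on the dual frame, the torsion is -A D²f up to a term B independent of the pair of web
indices. Differences of torsion components therefore measure D²f on vectors e_a V - e_b V, which lie
in the kernel of Df and span it on the block. -/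
theorem torsion_eq_iff_infReducible {n r l k : ℕ} (hl : 1 ≤ l) (hlk : l < k) (hkn : k < n)
    {f : (Fin n → Vec r) → Vec r}
    {z : Fin n → Vec r} {η : Fin n → (Fin n → Vec r) → (Fin n → Vec r) →L[ℝ] Vec r}
    (hf : SmoothNear f z) (hinj : ∀ᶠ w in 𝓝 z, PartialsInjective f w)
    (hω : ∀ α, DifferentiableAt ℝ (η α) z)
    (hA : ∀ᶠ w in 𝓝 z, ∃ A : Vec r →L[ℝ] Vec r, Function.Injective A ∧
      ∀ α v, η α w v = A (fderiv ℝ f w (Pi.single α (v α))))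
    {θ : Fin r → Fin r → (Fin n → Vec r) → ℝ} {t : Fin n → Fin n → Fin r → Fin r → Fin r → ℝ}
    (hstr : StructureAt η θ t z) (ht : ∀ α β i j m, α ≠ β → t α β i j m = t β α i m j) :
    (∀ p a b : Fin n, p.val < l → l ≤ a.val → a.val < k → l ≤ b.val → b.val < k →
      ∀ i j m, t p a i j m = t p b i j m) ↔ InfReducible l k f z := by
  obtain ⟨A, hAd, hAi, hAω⟩ := exists_differentiable_factor ⟨0, by omega⟩ hf hinj hω hA
  have hz := hAω.self_of_nhds
  have hsymm := hf.contDiffAt.fderiv_fderiv_comm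
  set f'' := fderiv ℝ (fderiv ℝ f) z with hf''
  -- the dual frame
  have hR : ∀ α, Function.Injective (A z ∘L partialDeriv f α z) := fun α =>
    hAi.comp (hinj.self_of_nhds α)
  let e : Fin n → Vec r →ₗ[ℝ] (Fin n → Vec r) := fun α =>
    LinearMap.single ℝ (fun _ : Fin n => Vec r) α ∘ₗ
      (LinearEquiv.ofInjectiveEndo (A z ∘L partialDeriv f α z).toLinearMap (hR α)).symm
  have he0 : ∀ α β U, β ≠ α → e α U β = 0 := fun α β U h => Pi.single_eq_of_ne h _
  have heA : ∀ α U, A z (fderiv ℝ f z (e α U)) = U := fun α U =>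
    (LinearEquiv.ofInjectiveEndo (A z ∘L partialDeriv f α z).toLinearMap (hR α)).apply_symm_apply U
  have hes : ∀ α U, Pi.single α (e α U α) = e α U := by
    intro α U
    ext1 β
    by_cases h : β = α
    · subst h
      rw [Pi.single_eq_same]
    · rw [Pi.single_eq_of_ne h, he0 α β U h]
  have heω : ∀ α U, η α z (e α U) = U := fun α U => by rw [hz, hes, heA]
  have heω0 : ∀ α β U, β ≠ α → η β z (e α U) = 0 := fun α β U h => by
    rw [hz, he0 α β U h, Pi.single_zero, map_zero, map_zero]
  have hωe : ∀ α v, e α (η α z v) = Pi.single α (v α) := by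
    intro α v
    rw [← hes]
    congr 1
    refine hR α ?_
    change A z (fderiv ℝ f z (Pi.single α (e α (η α z v) α))) =
      A z (fderiv ℝ f z (Pi.single α (v α)))
    rw [hes, heA, hz]
  have hc : ∀ α β U, fderiv ℝ f z (e α U) = fderiv ℝ f z (e β U) := fun α β U =>
    hAi (by rw [heA, heA])
  have hdω : ∀ α u v, fderiv ℝ (η α) z u v =
      fderiv ℝ A z u (fderiv ℝ f z (Pi.single α (v α))) + A z (f'' u (Pi.single α (v α))) := by
    intro α u v
    have h1 : HasFDerivAt (fun w => η α w v) _ z :=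
      (hω α).hasFDerivAt.clm_apply (hasFDerivAt_const v z)
    have h2 := hAd.hasFDerivAt.clm_apply (hf.contDiffAt.differentiableAt_fderiv.hasFDerivAt.clm_apply
      (hasFDerivAt_const (Pi.single α (v α) : Fin n → Vec r) z))
    have h3 := h1.unique (h2.congr_of_eventuallyEq (hAω.mono fun w hw => hw α v))
    have h4 := congrArg (fun L : (Fin n → Vec r) →L[ℝ] Vec r => L u) h3
    simpa [add_comm] using h4
  let α₀ : Fin n := ⟨0, by omega⟩
  -- B collects the derivative of A and the connection forms. By `hc` the vector Df(e_α U) is the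
  -- same for all α, so a fixed α₀ may be used.
  let B : Fin n → Vec r → Vec r → Fin r → ℝ := fun β V U i =>
    fderiv ℝ A z (e β V) (fderiv ℝ f z (e α₀ U)) i + ∑ j, U j * θ i j (e β V)
  let T : Fin n → Fin n → Vec r → Vec r → Fin r → ℝ := fun α β U V i =>
    ∑ j, ∑ m, t α β i j m * (U j * V m)
  have hT : ∀ α β U V i, α ≠ β → T α β U V i = - B β V U i - A z (f'' (e β V) (e α U)) i := by
    intro α β U V i hαβ
    have h1 := hstr α i (e α U) (e β V)
    rw [dForm_eq, hdω, hdω, he0 β α V hαβ, hes, heω, heω0 β α V hαβ, Pi.single_zero,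
      map_zero, map_zero, map_zero, map_zero, zero_add, hc α α₀] at h1
    rw [Finset.sum_eq_single β] at h1
    · simp only [heω, heω0 α β U hαβ.symm, PiLp.zero_apply, zero_mul, sub_zero, zero_sub,
        PiLp.neg_apply, PiLp.add_apply] at h1
      simp only [T, B]
      linarith
    · intro γ _ hγ
      simp [heω0 β γ V hγ]
    · intro h
      exact absurd (by simpa using hαβ.symm) h
  have hTs : ∀ α β U V i, α ≠ β → T α β U V i = T β α V U i := by
    intro α β U V i h
    simp only [T]
    rw [Finset.sum_comm]
    refine Finset.sum_congr rfl fun m _ => Finset.sum_congr rfl fun j _ => ?_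
    rw [ht α β i j m h, mul_comm (U j)]
  have hBs : ∀ α β U V i, α ≠ β → B β V U i = B α U V i := by
    intro α β U V i h
    have h1 := hTs α β U V i h
    rw [hT α β U V i h, hT β α V U i h.symm, hsymm] at h1
    linarith
  have hB : ∀ α β U V i, B α U V i = B β U V i := by
    intro α β U V i
    -- From 1 ≤ l < k < n there are at least three indices; comparing α and β with a third one γ
    -- removes the dependence of B on the index.
    obtain ⟨γ, hγ⟩ : ∃ γ : Fin n, γ ∉ ({α, β} : Finset (Fin n)) := by
      by_contra! h
      have h1 : (Finset.univ : Finset (Fin n)) ⊆ {α, β} := fun γ _ => h γ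
      have h2 := Finset.card_le_card h1
      have h3 := Finset.card_le_two (a := α) (b := β)
      rw [Finset.card_univ, Fintype.card_fin] at h2
      omega
    simp only [Finset.mem_insert, Finset.mem_singleton, not_or] at hγ
    rw [← hBs α γ U V i (Ne.symm hγ.1), hBs β γ U V i (Ne.symm hγ.2)]
  have hdiff : ∀ p a b : Fin n, p ≠ a → p ≠ b → ∀ U V i,
      (T p a U V i = T p b U V i ↔ A z (f'' (e p U) (e a V)) i = A z (f'' (e p U) (e b V)) i) := by
    intro p a b ha hb U V i
    rw [hT p a U V i ha, hT p b U V i hb, hB a b, hsymm (e a V), hsymm (e b V)]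
    constructor <;> intro h <;> linarith
  constructor
  · intro h ε v hε hv h0
    have hQ : ∀ p a b : Fin n, p.val < l → l ≤ a.val → a.val < k → l ≤ b.val → b.val < k →
        ∀ U V, f'' (e p U) (e a V) = f'' (e p U) (e b V) := by
      intro p a b hp ha ha' hb hb' U V
      refine hAi ?_
      ext i
      refine (hdiff p a b ?_ ?_ U V i).1 ?_
      · rintro rfl
        omega
      · rintro rfl
        omega
      · simp only [T, h p a b hp ha ha' hb hb']
    rw [← Finset.univ_sum_single ε, map_sum, sum_apply]
    refine Finset.sum_eq_zero fun p _ => ?_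
    by_cases hp : l ≤ p.val
    · rw [hε p hp, Pi.single_zero, map_zero]
      rfl
    · let b : Fin n := ⟨l, by omega⟩
      rw [← hωe p ε, ← sum_fderiv_single (f'' _) v]
      have h1 : ∀ a, f'' (e p (η p z ε)) (Pi.single a (v a)) =
          f'' (e p (η p z ε)) (e b (η a z v)) := by
        intro a
        by_cases ha : l ≤ a.val ∧ a.val < k
        · rw [← hωe a v]
          exact hQ p a b (by omega) ha.1 ha.2 le_rfl hlk _ _
        · rw [hz a v, hv a ha, Pi.single_zero]
          simp only [map_zero]
      rw [Finset.sum_congr rfl fun a _ => h1 a, ← map_sum, ← map_sum]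
      have h2 : ∑ a, η a z v = 0 := by
        simp only [hz]
        rw [← map_sum, sum_fderiv_single, h0, map_zero]
      rw [h2, map_zero, map_zero]
  · intro h p a b hp ha ha' hb hb' i j m
    have hpa : p ≠ a := by
      rintro rfl
      omega
    have hpb : p ≠ b := by
      rintro rfl
      omega
    have h1 : ∀ U V, f'' (e p U) (e a V - e b V) = 0 := by
      intro U V
      refine h _ _ (fun α hα => he0 p α U ?_) (fun α hα => ?_) ?_
      · rintro rfl
        omega
      · rw [Pi.sub_apply, he0 a α V, he0 b α V, sub_zero]
        · rintro rfl
          exact hα ⟨hb, hb'⟩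
        · rintro rfl
          exact hα ⟨ha, ha'⟩
      · rw [map_sub, hc a b, sub_self]
    have h2 := (hdiff p a b hpa hpb (EuclideanSpace.single j 1) (EuclideanSpace.single m 1) i).2 (by
      have := h1 (EuclideanSpace.single j 1) (EuclideanSpace.single m 1)
      rw [map_sub, sub_eq_zero] at this
      rw [this])
    simpa [T] using h2

/-! ### Existence of torsion components -/

theorem sum_symm_mul_alternating {r : ℕ} {s : Fin r → Fin r → ℝ} (hs : ∀ j m, s j m = s m j)
    (x y : Fin r → ℝ) : ∑ j, ∑ m, s j m * (x j * y m - y j * x m) = 0 := by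
  have h : ∑ j, ∑ m, s j m * (x j * y m - y j * x m) =
      -∑ j, ∑ m, s j m * (x j * y m - y j * x m) := by
    conv_rhs => rw [Finset.sum_comm]
    simp only [← Finset.sum_neg_distrib]
    refine Finset.sum_congr rfl fun j _ => Finset.sum_congr rfl fun m _ => ?_
    rw [hs m j]
    ring
  linarith

/-- For η_α = (∂f/∂x_α) dx_α one has dη_α = -∑ h_{αβ} η_α ∧ η_β, with h the components of D²f in the
dual frame. A connection ∑ b η_β adds the same b to every pair and leaves the torsion -h - b, so b
can be chosen to make the total torsion zero. -/
theorem exists_structureAt {n r : ℕ} (hn : 2 ≤ n) {f : (Fin n → Vec r) → Vec r}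
    {Ω : Set (Fin n → Vec r)} (hΩ : IsOpen Ω) (hf : ContDiffOn ℝ ∞ f Ω)
    (hinj : ∀ w ∈ Ω, PartialsInjective f w) :
    ∃ (θ : Fin r → Fin r → (Fin n → Vec r) → (Fin n → Vec r) →L[ℝ] ℝ)
      (t : Fin n → Fin n → Fin r → Fin r → Fin r → (Fin n → Vec r) → ℝ),
      (∀ i j, ContDiffOn ℝ ∞ (θ i j) Ω) ∧ (∀ α β i j m, ContDiffOn ℝ ∞ (t α β i j m) Ω) ∧
      ∀ z ∈ Ω, StructureAt (fun α w => (partialDeriv f α w) ∘L ContinuousLinearMap.proj α)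
          (fun i j => θ i j z) (fun α β i j m => t α β i j m z) z ∧
        (∀ α β i j m, t α β i j m z = t β α i m j z) ∧
        ∀ i j m, ∑ α : Fin n, ∑ β : Fin n with β ≠ α, t α β i j m z = 0 := by
  have hfa : ∀ w ∈ Ω, ContDiffAt ℝ ∞ f w := fun w hw => hf.contDiffAt (hΩ.mem_nhds hw)
  have hf' : ∀ w ∈ Ω, ContDiffAt ℝ ∞ (fderiv ℝ f) w := fun w hw =>
    (hfa w hw).fderiv_right (by simp)
  have hf'' : ∀ w ∈ Ω, ContDiffAt ℝ ∞ (fderiv ℝ (fderiv ℝ f)) w := fun w hw =>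
    (hf' w hw).fderiv_right (by simp)
  have hP : ∀ α, ∀ w ∈ Ω, ContDiffAt ℝ ∞ (partialDeriv f α) w := fun α w hw =>
    (hf' w hw).clm_comp contDiffAt_const
  -- the dual frame
  let e : Fin n → (Fin n → Vec r) → Vec r →L[ℝ] (Fin n → Vec r) := fun α w =>
    ContinuousLinearMap.single ℝ (fun _ : Fin n => Vec r) α ∘L (partialDeriv f α w).inverse
  have he : ∀ α, ∀ w ∈ Ω, ContDiffAt ℝ ∞ (e α) w := fun α w hw =>
    contDiffAt_const.clm_comp
      ((((hinj w hw).isInvertible α).contDiffAt_map_inverse).comp w (hP α w hw))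
  let η : Fin n → (Fin n → Vec r) → (Fin n → Vec r) →L[ℝ] Vec r := fun α w =>
    (partialDeriv f α w) ∘L ContinuousLinearMap.proj α
  have hη : ∀ α, ∀ w ∈ Ω, ContDiffAt ℝ ∞ (η α) w := fun α w hw =>
    (hP α w hw).clm_comp contDiffAt_const
  have heη : ∀ w ∈ Ω, ∀ α v, e α w (η α w v) = Pi.single α (v α) := by
    intro w hw α v
    change (Pi.single α ((partialDeriv f α w).inverse (partialDeriv f α w (v α))) : Fin n → Vec r) = _
    rw [((hinj w hw).isInvertible α).inverse_apply_self]
  let δ : Fin r → Vec r := fun j => EuclideanSpace.single j 1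
  have hδ : ∀ U : Vec r, ∑ j, U j • δ j = U := by
    intro U
    ext i
    simp [δ, Pi.single_apply]
  let h : Fin n → Fin n → Fin r → Fin r → Fin r → (Fin n → Vec r) → ℝ := fun α β i j m w =>
    fderiv ℝ (fderiv ℝ f) w (e α w (δ j)) (e β w (δ m)) i
  have hh : ∀ α β i j m, ∀ w ∈ Ω, ContDiffAt ℝ ∞ (h α β i j m) w := by
    intro α β i j m w hw
    have h1 := ((hf'' w hw).clm_apply ((he α w hw).clm_apply (contDiffAt_const (c := δ j)))).clm_apply
      ((he β w hw).clm_apply (contDiffAt_const (c := δ m)))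
    exact (EuclideanSpace.proj i : Vec r →L[ℝ] ℝ).contDiff.contDiffAt.comp w h1
  have hhs : ∀ α β i j m, ∀ w ∈ Ω, h α β i j m w = h β α i m j w := by
    intro α β i j m w hw
    simp only [h]
    rw [(hfa w hw).fderiv_fderiv_comm]
  -- Minus the mean of h over the n(n - 1) ordered pairs of distinct indices.
  let b : Fin r → Fin r → Fin r → (Fin n → Vec r) → ℝ := fun i j m w =>
    -((n : ℝ) * (n - 1))⁻¹ * ∑ α : Fin n, ∑ β : Fin n with β ≠ α, h α β i j m w
  have hb : ∀ i j m, ∀ w ∈ Ω, ContDiffAt ℝ ∞ (b i j m) w := fun i j m w hw =>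
    contDiffAt_const.mul (ContDiffAt.sum fun α _ => ContDiffAt.sum fun β _ => hh α β i j m w hw)
  have hbs : ∀ i j m, ∀ w ∈ Ω, b i j m w = b i m j w := by
    intro i j m w hw
    simp only [b]
    congr 1
    simp only [Finset.sum_filter]
    rw [Finset.sum_comm]
    refine Finset.sum_congr rfl fun α _ => Finset.sum_congr rfl fun β _ => ?_
    rw [hhs β α i j m w hw]
    simp only [ne_comm]
  let t : Fin n → Fin n → Fin r → Fin r → Fin r → (Fin n → Vec r) → ℝ := fun α β i j m w =>
    -h α β i j m w - b i j m w
  let θ : Fin r → Fin r → (Fin n → Vec r) → (Fin n → Vec r) →L[ℝ] ℝ := fun i j w =>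
    ∑ β, ∑ m, b i j m w • ((EuclideanSpace.proj m : Vec r →L[ℝ] ℝ) ∘L η β w)
  refine ⟨θ, t, ?_, ?_, ?_⟩
  · intro i j w hw
    refine ContDiffAt.contDiffWithinAt (ContDiffAt.sum fun β _ => ContDiffAt.sum fun m _ => ?_)
    exact (hb i j m w hw).smul (contDiffAt_const.clm_comp (hη β w hw))
  · intro α β i j m w hw
    exact ((hh α β i j m w hw).neg.sub (hb i j m w hw)).contDiffWithinAt
  intro z hz
  refine ⟨?_, ?_, ?_⟩
  · intro α i u v
    have hdη : ∀ u v, fderiv ℝ (η α) z u v =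
        fderiv ℝ (fderiv ℝ f) z u (Pi.single α (v α)) := by
      intro u v
      have h1 := ((hf' z hz).differentiableAt (by simp)).hasFDerivAt.clm_comp
        (hasFDerivAt_const (ContinuousLinearMap.single ℝ (fun _ : Fin n => Vec r) α ∘L
          (ContinuousLinearMap.proj α : (Fin n → Vec r) →L[ℝ] Vec r)) z)
      have h2 : HasFDerivAt (η α) _ z := h1
      rw [h2.fderiv]
      simp
    have hexp : ∀ u v, fderiv ℝ (fderiv ℝ f) z u (Pi.single α (v α)) i =
        ∑ β, ∑ j, ∑ m, h α β i j m z * (η α z v j * η β z u m) := by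
      intro u v
      have e1 : u = ∑ β, ∑ m, η β z u m • e β z (δ m) := by
        conv_lhs => rw [← Finset.univ_sum_single u]
        refine Finset.sum_congr rfl fun β _ => ?_
        rw [← heη z hz β u]
        conv_lhs => rw [← hδ (η β z u)]
        simp only [map_sum, map_smul]
      have e2 : (Pi.single α (v α) : Fin n → Vec r) = ∑ j, η α z v j • e α z (δ j) := by
        rw [← heη z hz α v]
        conv_lhs => rw [← hδ (η α z v)]
        simp only [map_sum, map_smul]
      rw [(hfa z hz).fderiv_fderiv_comm, e2]
      conv_lhs => rw [e1]
      simp only [map_sum, map_smul, sum_apply, smul_apply, WithLp.ofLp_sum, WithLp.ofLp_smul,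
        Finset.sum_apply, Pi.smul_apply, smul_eq_mul, Finset.mul_sum]
      refine Finset.sum_congr rfl fun β _ => ?_
      rw [Finset.sum_comm]
      refine Finset.sum_congr rfl fun j _ => Finset.sum_congr rfl fun m _ => ?_
      simp only [h]
      ring
    have hL : dForm (η α) z u v i = ∑ β, ∑ j, ∑ m,
        -h α β i j m z * (η α z u j * η β z v m - η α z v j * η β z u m) := by
      rw [dForm_eq, hdη, hdη, PiLp.sub_apply, hexp, hexp]
      simp only [← Finset.sum_sub_distrib]
      refine Finset.sum_congr rfl fun β _ => Finset.sum_congr rfl fun j _ =>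
        Finset.sum_congr rfl fun m _ => ?_
      ring
    have hC : ∑ j, (η α z u j * θ i j z v - η α z v j * θ i j z u) = ∑ β, ∑ j, ∑ m,
        b i j m z * (η α z u j * η β z v m - η α z v j * η β z u m) := by
      rw [Finset.sum_comm]
      refine Finset.sum_congr rfl fun j _ => ?_
      simp only [θ, sum_apply, smul_apply, smul_eq_mul, Finset.mul_sum, ← Finset.sum_sub_distrib]
      refine Finset.sum_congr rfl fun β _ => Finset.sum_congr rfl fun m _ => ?_
      simp only [ContinuousLinearMap.comp_apply]
      change η α z u j * (b i j m z * η β z v m) - η α z v j * (b i j m z * η β z u m) = _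
      ring
    -- The torsion sum omits β = α; the corresponding terms of dη_α and of the connection cancel out
    -- because their coefficients are symmetric in j, m.
    have hself : ∑ j, ∑ m, (b i j m z + h α α i j m z) *
        (η α z u j * η α z v m - η α z v j * η α z u m) = 0 :=
      sum_symm_mul_alternating (fun j m => by rw [hbs i j m z hz, hhs α α i j m z hz]) _ _
    change dForm (η α) z u v i = ∑ j, (η α z u j * θ i j z v - η α z v j * θ i j z u) +
      ∑ β : Fin n with β ≠ α, ∑ j, ∑ m, t α β i j m z *
        (η α z u j * η β z v m - η α z v j * η β z u m)
    rw [hL, hC]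
    have hsplit : ∀ G : Fin n → ℝ, ∑ β, G β = G α + ∑ β : Fin n with β ≠ α, G β := by
      intro G
      rw [Finset.filter_ne', Finset.add_sum_erase _ _ (Finset.mem_univ α)]
    rw [hsplit, hsplit (fun β => ∑ j, ∑ m, b i j m z * _), add_assoc, ← Finset.sum_add_distrib]
    have h1 : ∀ β, (∑ j, ∑ m, b i j m z * (η α z u j * η β z v m - η α z v j * η β z u m)) +
        (∑ j, ∑ m, t α β i j m z * (η α z u j * η β z v m - η α z v j * η β z u m)) =
        ∑ j, ∑ m, -h α β i j m z * (η α z u j * η β z v m - η α z v j * η β z u m) := by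
      intro β
      simp only [← Finset.sum_add_distrib]
      refine Finset.sum_congr rfl fun j _ => Finset.sum_congr rfl fun m _ => ?_
      simp only [t]
      ring
    rw [Finset.sum_congr rfl fun β _ => h1 β]
    congr 1
    rw [← sub_eq_zero, ← neg_eq_zero, ← hself]
    simp only [← Finset.sum_sub_distrib, ← Finset.sum_neg_distrib]
    refine Finset.sum_congr rfl fun j _ => Finset.sum_congr rfl fun m _ => ?_
    ring
  · intro α β i j m
    simp only [t]
    rw [hhs α β i j m z hz, hbs i j m z hz]
  · intro i j m
    have hcard : ∀ α : Fin n, (Finset.univ.filter fun β : Fin n => β ≠ α).card = n - 1 := by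
      intro α
      rw [Finset.filter_ne', Finset.card_erase_of_mem (Finset.mem_univ α), Finset.card_univ,
        Fintype.card_fin]
    have hcast : ((n - 1 : ℕ) : ℝ) = (n : ℝ) - 1 := by
      rw [Nat.cast_sub (by omega), Nat.cast_one]
    have hn0 : (n : ℝ) ≠ 0 := Nat.cast_ne_zero.2 (by omega)
    have hn1 : (n : ℝ) - 1 ≠ 0 := sub_ne_zero.2 (by exact_mod_cast (by omega : n ≠ 1))
    simp only [t, Finset.sum_sub_distrib, Finset.sum_neg_distrib, Finset.sum_const, hcard,
      Finset.card_univ, Fintype.card_fin, nsmul_eq_mul, hcast, b]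
    field_simp
    ring

/-! ### First integrals as coordinates; closed form equations -/

theorem exists_chart_of_injective_mfderiv {N : ℕ} {X : Type*} [TopologicalSpace X]
    [ChartedSpace (Vec N) X] [IsManifold (𝓡 N) ∞ X] {φ : X → Vec N} {U : Set X} (hU : IsOpen U)
    (hφ : ContMDiffOn (𝓡 N) (𝓡 N) ∞ φ U)
    (hinj : ∀ p ∈ U, Function.Injective (mfderiv (𝓡 N) (𝓡 N) φ p)) {q : X} (hq : q ∈ U) :
    ∃ Φ ∈ IsManifold.maximalAtlas (𝓡 N) ∞ X, q ∈ Φ.source ∧ Φ.source ⊆ U ∧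
      ∀ p ∈ Φ.source, Φ p = φ p := by
  let c := chartAt (Vec N) q
  let V : Set (Vec N) := c.target ∩ c.symm ⁻¹' U
  have hV : IsOpen V := c.isOpen_inter_preimage_symm hU
  have hcs : ContMDiffOn (𝓡 N) (𝓡 N) ∞ c.symm c.target := contMDiffOn_chart_symm
  have hc : ContMDiffOn (𝓡 N) (𝓡 N) ∞ c c.source := contMDiffOn_chart
  have hΨ : ContDiffOn ℝ ∞ (φ ∘ c.symm) V :=
    contMDiffOn_iff_contDiffOn.1
      (hφ.comp (hcs.mono Set.inter_subset_left) Set.inter_subset_right)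
  have hΨi : ∀ w ∈ V, Function.Injective (fderiv ℝ (φ ∘ c.symm) w) := by
    intro w hw
    have h1 : MDifferentiableAt (𝓡 N) (𝓡 N) φ (c.symm w) :=
      (hφ.contMDiffAt (hU.mem_nhds hw.2)).mdifferentiableAt (by simp)
    have h2 : MDifferentiableAt (𝓡 N) (𝓡 N) c.symm w :=
      (hcs.contMDiffAt (c.open_target.mem_nhds hw.1)).mdifferentiableAt (by simp)
    rw [← mfderiv_eq_fderiv, mfderiv_comp w h1 h2]
    have h3 := (mdifferentiable_chart (I := 𝓡 N) q).symm.mfderiv_injective (x := w) hw.1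
    exact (hinj _ hw.2).comp h3
  have hqs : q ∈ c.source := mem_chart_source _ q
  have hqV : c q ∈ V := ⟨c.map_source hqs, by
    change c.symm (c q) ∈ U
    rwa [c.left_inv hqs]⟩
  obtain ⟨Θ, hzΘ, hΘV, hΘ, hΘs⟩ := exists_local_inverse rfl hV hΨ hΨi hqV
  have hval : ∀ p ∈ (c.trans Θ).source, (c.trans Θ) p = φ p := by
    intro p hp
    rw [OpenPartialHomeomorph.trans_source] at hp
    change Θ (c p) = φ p
    rw [hΘ, Function.comp_apply, c.left_inv hp.1]
  have hsub : (c.trans Θ).source ⊆ U := by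
    intro p hp
    rw [OpenPartialHomeomorph.trans_source] at hp
    have h1 : c.symm (c p) ∈ U := (hΘV hp.2).2
    rwa [c.left_inv hp.1] at h1
  refine ⟨c.trans Θ, ?_, ?_, hsub, hval⟩
  · refine (c.trans Θ).mem_maximalAtlas_of_contMDiffOn (I := 𝓡 N) (n := ∞) ?_ ?_
    · exact (hφ.mono hsub).congr hval
    · rw [OpenPartialHomeomorph.trans_target]
      exact hcs.comp ((contMDiffOn_iff_contDiffOn.2 hΘs).mono Set.inter_subset_left)
        Set.inter_subset_right
  · rw [OpenPartialHomeomorph.trans_source]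
    exact ⟨hqs, hzΘ⟩

/-- The map `(x_1, …, x_n)` formed from the first integrals `x_1, …, x_n, x_{n+1}`. -/
def coordMap {n r : ℕ} {X : Type*} (x : Fin (n + 1) → X → Vec r) (q : X) : Fin n → Vec r :=
  fun α => x α.castSucc q

/-- An identification of `(ℝ^r)^n` with `ℝ^{nr}`. -/
noncomputable def coordEquiv (n r : ℕ) : (Fin n → Vec r) ≃L[ℝ] Vec (n * r) :=
  ContinuousLinearEquiv.ofFinrankEq (by
    rw [Module.finrank_pi_fintype]
    simp)

section CoordMap

variable {n r : ℕ} {X : Type*} [TopologicalSpace X] [ChartedSpace (Vec (n * r)) X]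

theorem contMDiffOn_coordMap {x : Fin (n + 1) → X → Vec r} {U : Set X}
    (hx : ∀ ξ, ContMDiffOn (𝓡 (n * r)) (𝓡 r) ∞ (x ξ) U) :
    ContMDiffOn (𝓡 (n * r)) 𝓘(ℝ, Fin n → Vec r) ∞ (coordMap x) U :=
  contMDiffOn_pi_space.2 fun α => hx α.castSucc

/-- The derivative of `coordMap x`. -/
noncomputable def dcoord (x : Fin (n + 1) → X → Vec r) (q : X) :
    TangentSpace (𝓡 (n * r)) q →L[ℝ] (Fin n → Vec r) :=
  mfderiv (𝓡 (n * r)) 𝓘(ℝ, Fin n → Vec r) (coordMap x) q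

theorem dcoord_apply {x : Fin (n + 1) → X → Vec r} {U : Set X} (hU : IsOpen U)
    (hx : ∀ ξ, ContMDiffOn (𝓡 (n * r)) (𝓡 r) ∞ (x ξ) U) {q : X} (hq : q ∈ U)
    (v : TangentSpace (𝓡 (n * r)) q) (α : Fin n) :
    dcoord x q v α = mfderiv (𝓡 (n * r)) (𝓡 r) (x α.castSucc) q v := by
  have h1 : MDifferentiableAt (𝓡 (n * r)) 𝓘(ℝ, Fin n → Vec r) (coordMap x) q :=
    ((contMDiffOn_coordMap hx).contMDiffAt (hU.mem_nhds hq)).mdifferentiableAt (by simp)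
  let P : (Fin n → Vec r) →L[ℝ] Vec r := ContinuousLinearMap.proj α
  have h3 := mfderiv_comp (I'' := 𝓡 r) q (P.mdifferentiableAt) h1
  have h4 : mfderiv (𝓡 (n * r)) (𝓡 r) (x α.castSucc) q = _ := h3
  rw [h4, P.mfderiv_eq]
  rfl

/-- The kernel is the intersection of the tangent spaces of λ_1, …, λ_n, which is zero by general
position. -/
theorem injective_dcoord {W : Web n r X} {x : Fin (n + 1) → X → Vec r} {U : Set X} (hU : IsOpen U)
    (hx : ∀ ξ, ContMDiffOn (𝓡 (n * r)) (𝓡 r) ∞ (x ξ) U)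
    (hker : ∀ ξ, ∀ q ∈ U,
      W.tangent ξ q = LinearMap.ker (mfderiv (𝓡 (n * r)) (𝓡 r) (x ξ) q).toLinearMap)
    {q : X} (hq : q ∈ U) : Function.Injective (dcoord x q) := by
  refine (injective_iff_map_eq_zero _).2 fun v hv => ?_
  have h1 : v ∈ ⨅ (ξ : Fin (n + 1)) (_ : ξ ≠ Fin.last n), W.tangent ξ q := by
    simp only [Submodule.mem_iInf]
    intro ξ hξ
    obtain ⟨α, rfl⟩ := Fin.exists_castSucc_eq.2 hξ
    rw [hker _ q hq]
    change mfderiv (𝓡 (n * r)) (𝓡 r) (x α.castSucc) q v = 0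
    rw [← dcoord_apply hU hx hq, hv]
    rfl
  rw [W.general_position] at h1
  exact h1

theorem bijective_dcoord {W : Web n r X} {x : Fin (n + 1) → X → Vec r} {U : Set X} (hU : IsOpen U)
    (hx : ∀ ξ, ContMDiffOn (𝓡 (n * r)) (𝓡 r) ∞ (x ξ) U)
    (hker : ∀ ξ, ∀ q ∈ U,
      W.tangent ξ q = LinearMap.ker (mfderiv (𝓡 (n * r)) (𝓡 r) (x ξ) q).toLinearMap)
    {q : X} (hq : q ∈ U) : Function.Bijective (dcoord x q) := by
  have h1 := injective_dcoord hU hx hker hq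
  let D : Vec (n * r) →ₗ[ℝ] (Fin n → Vec r) := (dcoord x q).toLinearMap
  have h2 : Function.Injective D := h1
  refine ⟨h1, (LinearMap.injective_iff_surjective_of_finrank_eq_finrank (f := D) ?_).1 h2⟩
  exact (coordEquiv n r).symm.toLinearEquiv.finrank_eq

theorem exists_coord_chart [IsManifold (𝓡 (n * r)) ∞ X] {W : Web n r X}
    {x : Fin (n + 1) → X → Vec r} {U : Set X} (hU : IsOpen U)
    (hx : ∀ ξ, ContMDiffOn (𝓡 (n * r)) (𝓡 r) ∞ (x ξ) U)
    (hker : ∀ ξ, ∀ q ∈ U,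
      W.tangent ξ q = LinearMap.ker (mfderiv (𝓡 (n * r)) (𝓡 r) (x ξ) q).toLinearMap)
    {q : X} (hq : q ∈ U) :
    ∃ Φ ∈ IsManifold.maximalAtlas (𝓡 (n * r)) ∞ X, q ∈ Φ.source ∧ Φ.source ⊆ U ∧
      (∀ p ∈ Φ.source, Φ p = coordEquiv n r (coordMap x p)) ∧
      ∀ p ∈ Φ.source, ∀ v, mfderiv (𝓡 (n * r)) (𝓡 (n * r)) Φ p v = coordEquiv n r (dcoord x p v) := by
  have hc := contMDiffOn_coordMap hx
  have hs : ContMDiffOn (𝓡 (n * r)) (𝓡 (n * r)) ∞ (fun p => coordEquiv n r (coordMap x p)) U :=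
    (coordEquiv n r).contDiff.contMDiff.comp_contMDiffOn hc
  have hd : ∀ p ∈ U, ∀ v, mfderiv (𝓡 (n * r)) (𝓡 (n * r))
      (fun p => coordEquiv n r (coordMap x p)) p v = coordEquiv n r (dcoord x p v) := by
    intro p hp v
    have h1 : MDifferentiableAt (𝓡 (n * r)) 𝓘(ℝ, Fin n → Vec r) (coordMap x) p :=
      (hc.contMDiffAt (hU.mem_nhds hp)).mdifferentiableAt (by simp)
    have h3 := mfderiv_comp (I'' := 𝓡 (n * r)) p
      (coordEquiv n r).toContinuousLinearMap.mdifferentiableAt h1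
    have h4 : mfderiv (𝓡 (n * r)) (𝓡 (n * r)) (fun p => coordEquiv n r (coordMap x p)) p = _ := h3
    rw [h4, ContinuousLinearMap.mfderiv_eq]
    rfl
  obtain ⟨Φ, hΦ, hqΦ, hΦU, hval⟩ := exists_chart_of_injective_mfderiv hU hs (fun p hp => by
    intro v v' h
    rw [hd p hp, hd p hp] at h
    exact injective_dcoord hU hx hker hp ((coordEquiv n r).injective h)) hq
  refine ⟨Φ, hΦ, hqΦ, hΦU, hval, fun p hp v => ?_⟩
  rw [← hd p (hΦU hp)]
  have : Φ =ᶠ[𝓝 p] fun p => coordEquiv n r (coordMap x p) := by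
    filter_upwards [Φ.open_source.mem_nhds hp] with p' hp' using hval p' hp'
  rw [this.mfderiv_eq]
  rfl

end CoordMap

namespace Web

variable {n r : ℕ} {X : Type*} [TopologicalSpace X] [ChartedSpace (Vec (n * r)) X]

/-- On a common domain of first integrals of all foliations, the first n form a chart by general
position, and f is the last one written in that chart. -/
theorem exists_closedForm [IsManifold (𝓡 (n * r)) ∞ X] (W : Web n r X) (q : X) :
    ∃ C : W.ClosedForm, q ∈ C.U := by
  choose O u hO hqO hu hd using fun ξ => W.foliation ξ q (Set.mem_univ q)
  let U : Set X := ⋂ ξ, O ξ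
  have hU : IsOpen U := isOpen_iInter_of_finite hO
  have hqU : q ∈ U := Set.mem_iInter.2 hqO
  have hx : ∀ ξ, ContMDiffOn (𝓡 (n * r)) (𝓡 r) ∞ (u ξ) U := fun ξ =>
    (hu ξ).mono (Set.iInter_subset O ξ)
  have hker : ∀ ξ, ∀ q ∈ U,
      W.tangent ξ q = LinearMap.ker (mfderiv (𝓡 (n * r)) (𝓡 r) (u ξ) q).toLinearMap :=
    fun ξ p hp => (hd ξ p (Set.mem_iInter.1 hp ξ)).2
  obtain ⟨Φ, hΦ, hqΦ, hΦU, hval, -⟩ := exists_coord_chart hU hx hker hqU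
  have himage : (fun (q : X) (α : Fin n) => u α.castSucc q) '' Φ.source =
      coordEquiv n r ⁻¹' Φ.target := by
    ext w
    constructor
    · rintro ⟨p, hp, rfl⟩
      change coordEquiv n r (coordMap u p) ∈ Φ.target
      rw [← hval p hp]
      exact Φ.map_source hp
    · intro hw
      refine ⟨Φ.symm (coordEquiv n r w), Φ.map_target hw, (coordEquiv n r).injective ?_⟩
      change coordEquiv n r (coordMap u _) = _
      rw [← hval _ (Φ.map_target hw), Φ.right_inv hw]
  exact ⟨{
    U := Φ.source
    isOpen := Φ.open_source
    x := u
    smooth := fun ξ => (hx ξ).mono hΦU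
    surjective := fun ξ p hp => (hd ξ p (Set.mem_iInter.1 (hΦU hp) ξ)).1
    ker_eq := fun ξ p hp => hker ξ p (hΦU hp)
    injOn := by
      intro p hp p' hp' h
      refine Φ.injOn hp hp' ?_
      rw [hval p hp, hval p' hp']
      exact congrArg _ h
    isOpen_image := by
      rw [himage]
      exact Φ.open_target.preimage (coordEquiv n r).continuous
    f := fun w => u (Fin.last n) (Φ.symm (coordEquiv n r w))
    smooth_f := by
      rw [himage]
      have h1 : ContMDiffOn (𝓡 (n * r)) (𝓡 (n * r)) ∞ Φ.symm Φ.target :=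
        contMDiffOn_symm_of_mem_maximalAtlas hΦ
      have h2 : ContMDiffOn 𝓘(ℝ, Fin n → Vec r) (𝓡 (n * r)) ∞ (coordEquiv n r)
          (coordEquiv n r ⁻¹' Φ.target) := (coordEquiv n r).contDiff.contMDiff.contMDiffOn
      have h3 := ((hx (Fin.last n)).mono hΦU).comp h1 (fun y hy => Φ.map_target hy)
      exact contMDiffOn_iff_contDiffOn.1 (h3.comp h2 fun y hy => hy)
    eq := by
      intro p hp
      change u (Fin.last n) p = u (Fin.last n) (Φ.symm (coordEquiv n r (coordMap u p)))
      rw [← hval p hp, Φ.left_inv hp] }, hqΦ⟩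

end Web

/-! ### The web read in a closed form equation -/

namespace Web

variable {n r : ℕ} {X : Type*} [TopologicalSpace X] [ChartedSpace (Vec (n * r)) X] {W : Web n r X}

namespace ClosedForm

variable (C : W.ClosedForm)

theorem isOpen_image_coordMap : IsOpen (coordMap C.x '' C.U) := C.isOpen_image

theorem contDiffOn_f : ContDiffOn ℝ ∞ C.f (coordMap C.x '' C.U) := C.smooth_f

theorem contDiffAt_f {q : X} (hq : q ∈ C.U) : ContDiffAt ℝ ∞ C.f (coordMap C.x q) :=
  C.contDiffOn_f.contDiffAt (C.isOpen_image_coordMap.mem_nhds ⟨q, hq, rfl⟩)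

theorem smoothNear_f {q : X} (hq : q ∈ C.U) : SmoothNear C.f (coordMap C.x q) :=
  ⟨_, C.isOpen_image_coordMap, ⟨q, hq, rfl⟩, C.contDiffOn_f⟩

theorem eventually_coordMap {q : X} (hq : q ∈ C.U) {P : (Fin n → Vec r) → Prop}
    (h : ∀ p ∈ C.U, P (coordMap C.x p)) : ∀ᶠ w in 𝓝 (coordMap C.x q), P w := by
  filter_upwards [C.isOpen_image_coordMap.mem_nhds ⟨q, hq, rfl⟩]
  rintro _ ⟨p, hp, rfl⟩
  exact h p hp

theorem mdifferentiableAt_coordMap {q : X} (hq : q ∈ C.U) :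
    MDifferentiableAt (𝓡 (n * r)) 𝓘(ℝ, Fin n → Vec r) (coordMap C.x) q :=
  ((contMDiffOn_coordMap C.smooth).contMDiffAt (C.isOpen.mem_nhds hq)).mdifferentiableAt (by simp)

theorem bijective_dcoord {q : X} (hq : q ∈ C.U) : Function.Bijective (dcoord C.x q) :=
  _root_.bijective_dcoord C.isOpen C.smooth C.ker_eq hq

theorem mem_tangent_iff {q : X} (hq : q ∈ C.U) (α : Fin n) (v : TangentSpace (𝓡 (n * r)) q) :
    v ∈ W.tangent α.castSucc q ↔ dcoord C.x q v α = 0 := by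
  rw [C.ker_eq _ q hq, dcoord_apply C.isOpen C.smooth hq]
  rfl

theorem mem_tangent_last_iff {q : X} (hq : q ∈ C.U) (v : TangentSpace (𝓡 (n * r)) q) :
    v ∈ W.tangent (Fin.last n) q ↔ fderiv ℝ C.f (coordMap C.x q) (dcoord C.x q v) = 0 := by
  have h1 : C.x (Fin.last n) =ᶠ[𝓝 q] C.f ∘ coordMap C.x := by
    filter_upwards [C.isOpen.mem_nhds hq] with p hp using C.eq p hp
  have h2 : MDifferentiableAt 𝓘(ℝ, Fin n → Vec r) (𝓡 r) C.f (coordMap C.x q) :=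
    ((C.contDiffAt_f hq).differentiableAt (by simp)).mdifferentiableAt
  rw [C.ker_eq _ q hq]
  change mfderiv (𝓡 (n * r)) (𝓡 r) (C.x (Fin.last n)) q v = 0 ↔ _
  rw [h1.mfderiv_eq, mfderiv_comp q h2 (C.mdifferentiableAt_coordMap hq), mfderiv_eq_fderiv]
  rfl

/-- A vector killed by ∂f/∂x_α, placed in slot α, is tangent to λ_{n+1} and to every λ_β with β ≠ α;
general position of these n foliations makes it zero. -/
theorem partialsInjective {q : X} (hq : q ∈ C.U) : PartialsInjective C.f (coordMap C.x q) := by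
  intro α
  refine (injective_iff_map_eq_zero (partialDeriv C.f α (coordMap C.x q))).2 fun s hs => ?_
  obtain ⟨v, hv⟩ := (C.bijective_dcoord hq).2 (Pi.single α s)
  have h1 : v ∈ ⨅ (ξ : Fin (n + 1)) (_ : ξ ≠ α.castSucc), W.tangent ξ q := by
    simp only [Submodule.mem_iInf]
    intro ξ hξ
    induction ξ using Fin.lastCases with
    | last =>
      rw [C.mem_tangent_last_iff hq, hv]
      exact hs
    | cast β =>
      rw [C.mem_tangent_iff hq, hv]
      exact Pi.single_eq_of_ne (fun h => hξ (congrArg _ h)) _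
  rw [W.general_position] at h1
  have h2 : v = 0 := h1
  rw [h2, map_zero] at hv
  have h3 := congrFun hv α
  rw [Pi.single_eq_same] at h3
  exact h3.symm

/-- A local inverse of (x_1, …, x_n), used to pull functions and forms on the manifold back to
(ℝ^r)^n. -/
theorem exists_local_section [IsManifold (𝓡 (n * r)) ∞ X] {q : X} (hq : q ∈ C.U) :
    ∃ (κ : (Fin n → Vec r) → X) (O : Set (Fin n → Vec r)), IsOpen O ∧ coordMap C.x q ∈ O ∧
      κ (coordMap C.x q) = q ∧ ContMDiffOn 𝓘(ℝ, Fin n → Vec r) (𝓡 (n * r)) ∞ κ O ∧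
      ∀ w ∈ O, κ w ∈ C.U ∧ coordMap C.x (κ w) = w ∧
        ∀ v : Fin n → Vec r,
          dcoord C.x (κ w) (mfderiv 𝓘(ℝ, Fin n → Vec r) (𝓡 (n * r)) κ w v) = v := by
  obtain ⟨Φ, hΦ, hqΦ, hΦU, hval, -⟩ := exists_coord_chart C.isOpen C.smooth C.ker_eq hq
  let κ : (Fin n → Vec r) → X := fun w => Φ.symm (coordEquiv n r w)
  let O : Set (Fin n → Vec r) := coordEquiv n r ⁻¹' Φ.target
  have hO : IsOpen O := Φ.open_target.preimage (coordEquiv n r).continuous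
  have h1 : ContMDiffOn (𝓡 (n * r)) (𝓡 (n * r)) ∞ Φ.symm Φ.target :=
    contMDiffOn_symm_of_mem_maximalAtlas hΦ
  have h2 : ContMDiffOn 𝓘(ℝ, Fin n → Vec r) (𝓡 (n * r)) ∞ (coordEquiv n r) O :=
    (coordEquiv n r).contDiff.contMDiff.contMDiffOn
  have hκ : ContMDiffOn 𝓘(ℝ, Fin n → Vec r) (𝓡 (n * r)) ∞ κ O := h1.comp h2 fun y hy => hy
  have hκU : ∀ w ∈ O, κ w ∈ C.U := fun w hw => hΦU (Φ.map_target hw)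
  have hcκ : ∀ w ∈ O, coordMap C.x (κ w) = w := fun w hw => by
    refine (coordEquiv n r).injective ?_
    rw [← hval _ (Φ.map_target hw)]
    exact Φ.right_inv hw
  refine ⟨κ, O, hO, ?_, ?_, hκ, fun w hw => ⟨hκU w hw, hcκ w hw, fun v => ?_⟩⟩
  · change coordEquiv n r (coordMap C.x q) ∈ Φ.target
    rw [← hval q hqΦ]
    exact Φ.map_source hqΦ
  · change Φ.symm (coordEquiv n r (coordMap C.x q)) = q
    rw [← hval q hqΦ, Φ.left_inv hqΦ]
  · have h3 : MDifferentiableAt 𝓘(ℝ, Fin n → Vec r) (𝓡 (n * r)) κ w :=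
      (hκ.contMDiffAt (hO.mem_nhds hw)).mdifferentiableAt (by simp)
    have h4 := mfderiv_comp w (C.mdifferentiableAt_coordMap (hκU w hw)) h3
    have h5 : (coordMap C.x ∘ κ) =ᶠ[𝓝 w] id := by
      filter_upwards [hO.mem_nhds hw] with w' hw' using hcκ w' hw'
    rw [h5.mfderiv_eq, mfderiv_id] at h4
    exact (DFunLike.congr_fun h4 v).symm

theorem mfderiv_comp_coordMap {m : ℕ} {u : (Fin n → Vec r) → Vec m} {q : X} (hq : q ∈ C.U)
    (hu : DifferentiableAt ℝ u (coordMap C.x q)) (v : TangentSpace (𝓡 (n * r)) q) :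
    mfderiv (𝓡 (n * r)) (𝓡 m) (fun p => u (coordMap C.x p)) q v =
      fderiv ℝ u (coordMap C.x q) (dcoord C.x q v) := by
  have h := mfderiv_comp (I'' := 𝓡 m) q hu.mdifferentiableAt (C.mdifferentiableAt_coordMap hq)
  rw [mfderiv_eq_fderiv] at h
  exact DFunLike.congr_fun h v

theorem eventually_partialsInjective {q : X} (hq : q ∈ C.U) :
    ∀ᶠ w in 𝓝 (coordMap C.x q), PartialsInjective C.f w :=
  C.eventually_coordMap hq fun _ hp => C.partialsInjective hp

end ClosedForm

/-- Families of linear maps with the kernels of `x_1, …, x_n` and of `f' (x_1, …, x_n)` agree,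
up to a common factor, with `∂f/∂x_α dx_α`. -/
theorem exists_common_factor {T : Type*} [AddCommGroup T] [Module ℝ T] (α₀ : Fin n)
    {d : T →ₗ[ℝ] (Fin n → Vec r)} (hd : Function.Bijective d)
    {f : (Fin n → Vec r) → Vec r} {z : Fin n → Vec r} (hf : PartialsInjective f z)
    {η : Fin n → T →ₗ[ℝ] Vec r} (hη : ∀ α v, η α v = 0 ↔ d v α = 0)
    (hlast : ∀ v, ∑ α, η α v = 0 ↔ fderiv ℝ f z (d v) = 0) :
    ∃ A : Vec r →L[ℝ] Vec r, Function.Injective A ∧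
      ∀ α v, η α v = A (fderiv ℝ f z (Pi.single α (d v α))) := by
  let D := LinearEquiv.ofBijective d hd
  have hD : ∀ w, d (D.symm w) = w := fun w => D.apply_symm_apply w
  -- `J α s` points in the direction x_α and is normalized by df(J α s) = s.
  let J : Fin n → Vec r →ₗ[ℝ] T := fun α => D.symm.toLinearMap ∘ₗ
    LinearMap.single ℝ (fun _ : Fin n => Vec r) α ∘ₗ (partialDeriv f α z).inverse.toLinearMap
  have hdJ : ∀ α s, d (J α s) = Pi.single α ((partialDeriv f α z).inverse s) := fun α s => hD _
  have hfJ : ∀ α s, fderiv ℝ f z (d (J α s)) = s := fun α s => by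
    rw [hdJ, ← partialDeriv_apply, (hf.isInvertible α).self_apply_inverse]
  have h0 : ∀ α β s, β ≠ α → η β (J α s) = 0 := fun α β s h => by
    rw [hη, hdJ, Pi.single_eq_of_ne h]
  have hJ : ∀ β s, η β (J β s) = η α₀ (J α₀ s) := by
    intro β s
    -- The difference is tangent to λ_{n+1}, where ∑ η_α vanishes; this makes the factor independent
    -- of the index.
    have h1 : ∑ α, η α (J α₀ s - J β s) = 0 := by
      rw [hlast, map_sub, map_sub, hfJ, hfJ, sub_self]
    have h2 : ∀ γ, ∑ α, η α (J γ s) = η γ (J γ s) := fun γ =>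
      Finset.sum_eq_single γ (fun α _ hα => h0 γ α s hα) (fun h => absurd (Finset.mem_univ _) h)
    simp only [map_sub, Finset.sum_sub_distrib, h2] at h1
    exact (sub_eq_zero.1 h1).symm
  refine ⟨LinearMap.toContinuousLinearMap (η α₀ ∘ₗ J α₀), ?_, fun α v => ?_⟩
  · refine (injective_iff_map_eq_zero _).2 fun s hs => ?_
    have h1 : η α₀ (J α₀ s) = 0 := hs
    rw [hη, hdJ, Pi.single_eq_same] at h1
    rw [← (hf.isInvertible α₀).self_apply_inverse s, h1, map_zero]
  · change η α v = η α₀ (J α₀ _)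
    rw [← hJ α, ← sub_eq_zero, ← map_sub, hη, map_sub, hdJ, ← partialDeriv_apply,
      (hf.isInvertible α).inverse_apply_self, Pi.sub_apply, Pi.single_eq_same, sub_self]

namespace AdaptedCoframe

variable (S : W.AdaptedCoframe) (C : W.ClosedForm)

theorem form_eq (hn : 0 < n) {q : X} (hS : q ∈ S.chart.source) (hC : q ∈ C.U) :
    ∃ A : Vec r →L[ℝ] Vec r, Function.Injective A ∧ ∀ α (v : TangentSpace (𝓡 (n * r)) q),
      S.form α q v = A (fderiv ℝ C.f (coordMap C.x q) (Pi.single α (dcoord C.x q v α))) := by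
  refine exists_common_factor ⟨0, hn⟩ (d := (dcoord C.x q).toLinearMap) (C.bijective_dcoord hC)
    (C.partialsInjective hC) (η := fun α => (S.form α q).toLinearMap) ?_ ?_
  · intro α v
    exact (S.ker_eq q hS α v).symm.trans (C.mem_tangent_iff hC α v)
  · intro v
    exact (S.ker_last_eq q hS v).symm.trans (C.mem_tangent_last_iff hC v)

/-- The common injective factor A cancels from ∑ ω_a = 0, so the distribution depends only on f and
not on the coframe. -/
theorem mem_distribution_iff (hn : 0 < n) {l k : ℕ} {q : X} (hS : q ∈ S.chart.source)
    (hC : q ∈ C.U) (v : TangentSpace (𝓡 (n * r)) q) :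
    v ∈ S.distribution l k q ↔ ReductVector l k C.f (coordMap C.x q) (dcoord C.x q v) := by
  obtain ⟨A, hA, hform⟩ := S.form_eq C hn hS hC
  have h1 : ∀ α, S.form α q v = 0 ↔ dcoord C.x q v α = 0 := fun α =>
    (S.ker_eq q hS α v).symm.trans (C.mem_tangent_iff hC α v)
  have h2 : ∑ a : Fin n with l ≤ a.val ∧ a.val < k, S.form a q v =
      A (fderiv ℝ C.f (coordMap C.x q) (band n r l k (dcoord C.x q v))) := by
    rw [← sum_fderiv_single _ (band n r l k (dcoord C.x q v)), map_sum, Finset.sum_filter]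
    refine Finset.sum_congr rfl fun a _ => ?_
    rw [band_apply]
    split_ifs with h
    · exact hform a v
    · rw [Pi.single_zero, map_zero, map_zero]
  unfold distribution ReductVector
  rw [Submodule.mem_inf]
  refine and_congr ?_ ?_
  · simp only [Submodule.mem_iInf]
    exact forall₂_congr fun σ _ => h1 σ
  · rw [← map_eq_zero_iff A hA, ← h2, LinearMap.mem_ker]
    refine Eq.congr ?_ rfl
    simp

end AdaptedCoframe

end Web

/-! ### Adapted coframes on the manifold -/

namespace Web

variable {n r : ℕ} {X : Type*} [TopologicalSpace X] [ChartedSpace (Vec (n * r)) X] {W : Web n r X}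

namespace AdaptedCoframe

variable [IsManifold (𝓡 (n * r)) ∞ X]

/-- The structure equations are pulled back along the change from web coordinates to the chart of
the coframe; d commutes with pullback, so the torsion components keep their values. -/
theorem torsion_eq_iff (S : W.AdaptedCoframe) (C : W.ClosedForm) {l k : ℕ} (hl : 1 ≤ l)
    (hlk : l < k) (hkn : k < n) {q : X} (hS : q ∈ S.chart.source) (hC : q ∈ C.U)
    {θ : Fin r → Fin r → Vec (n * r) → Vec (n * r) →L[ℝ] ℝ}
    {t : Fin n → Fin n → Fin r → Fin r → Fin r → Vec (n * r) → ℝ}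
    (hst : S.StructureEquations θ t) :
    (∀ p a b : Fin n, p.val < l → l ≤ a.val → a.val < k → l ≤ b.val → b.val < k →
      ∀ i j m, t p a i j m (S.chart q) = t p b i j m (S.chart q)) ↔
    InfReducible l k C.f (coordMap C.x q) := by
  obtain ⟨κ, O, hO, hqO, hκq, hκ, hκO⟩ := C.exists_local_section hC
  let O' : Set (Fin n → Vec r) := O ∩ κ ⁻¹' S.chart.source
  have hO' : IsOpen O' := hκ.continuousOn.isOpen_inter_preimage hO S.chart.open_source
  have hqO' : coordMap C.x q ∈ O' := ⟨hqO, by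
    change κ (coordMap C.x q) ∈ S.chart.source
    rwa [hκq]⟩
  let χ : (Fin n → Vec r) → Vec (n * r) := fun w => S.chart (κ w)
  have hSc : ContMDiffOn (𝓡 (n * r)) (𝓡 (n * r)) ∞ S.chart S.chart.source :=
    contMDiffOn_of_mem_maximalAtlas S.chart_mem
  have hχ : ContDiffOn ℝ ∞ χ O' := contMDiffOn_iff_contDiffOn.1
    (hSc.comp (hκ.mono Set.inter_subset_left) Set.inter_subset_right)
  have hχa : ∀ w ∈ O', ContDiffAt ℝ ∞ χ w := fun w hw => hχ.contDiffAt (hO'.mem_nhds hw)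
  have hform : ∀ α, ∀ w ∈ O', DifferentiableAt ℝ (S.coordForm α) (χ w) := fun α w hw =>
    ((S.smooth α).contDiffAt
      (S.chart.open_target.mem_nhds (S.chart.map_source hw.2))).differentiableAt (by simp)
  let η : Fin n → (Fin n → Vec r) → (Fin n → Vec r) →L[ℝ] Vec r := fun α w =>
    (S.coordForm α (χ w)) ∘L fderiv ℝ χ w
  have hηd : ∀ α, DifferentiableAt ℝ (η α) (coordMap C.x q) := fun α =>
    ((hform α _ hqO').comp _ ((hχa _ hqO').differentiableAt (by simp))).clm_comp
      (hχa _ hqO').differentiableAt_fderiv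
  have hη : ∀ w ∈ O', ∀ α v, η α w v =
      S.form α (κ w) (mfderiv 𝓘(ℝ, Fin n → Vec r) (𝓡 (n * r)) κ w v) := by
    intro w hw α v
    have h1 : MDifferentiableAt 𝓘(ℝ, Fin n → Vec r) (𝓡 (n * r)) κ w :=
      (hκ.contMDiffAt (hO.mem_nhds hw.1)).mdifferentiableAt (by simp)
    have h2 : MDifferentiableAt (𝓡 (n * r)) (𝓡 (n * r)) S.chart (κ w) :=
      (hSc.contMDiffAt (S.chart.open_source.mem_nhds hw.2)).mdifferentiableAt (by simp)
    have h3 := mfderiv_comp w h2 h1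
    rw [mfderiv_eq_fderiv] at h3
    exact congrArg (S.coordForm α (χ w)) (DFunLike.congr_fun h3 v)
  have hA : ∀ᶠ w in 𝓝 (coordMap C.x q), ∃ A : Vec r →L[ℝ] Vec r, Function.Injective A ∧
      ∀ α v, η α w v = A (fderiv ℝ C.f w (Pi.single α (v α))) := by
    filter_upwards [hO'.mem_nhds hqO'] with w hw
    obtain ⟨hwU, hcw, hdw⟩ := hκO w hw.1
    obtain ⟨A, hAi, hA⟩ := S.form_eq C (by omega) hw.2 hwU
    refine ⟨A, hAi, fun α v => ?_⟩
    rw [hη w hw, hA, hdw, hcw]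
  have hχq : χ (coordMap C.x q) = S.chart q := congrArg S.chart hκq
  have hy : S.chart q ∈ S.chart.target := S.chart.map_source hS
  refine torsion_eq_iff_infReducible hl hlk hkn (C.smoothNear_f hC)
    (C.eventually_partialsInjective hC) hηd hA
    (θ := fun i j v => θ i j (S.chart q) (fderiv ℝ χ (coordMap C.x q) v))
    (t := fun α β i j m => t α β i j m (S.chart q)) ?_
    (fun α β i j m h => hst.torsion_symm _ hy α β i j m h)
  intro α i u v
  have h1 := dForm_pullback (hχa _ hqO') (hform α _ hqO') u v
  have h2 := hst.structure_eq _ hy α i (fderiv ℝ χ (coordMap C.x q) u)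
    (fderiv ℝ χ (coordMap C.x q) v)
  rw [← hχq, ← h1] at h2
  rw [← hχq]
  exact h2

end AdaptedCoframe

/-- The forms (∂f/∂x_α) dx_α sum to df = dx_{n+1}, so they are adapted. Their structure equations
are carried to the chart by the linear identification `L` of ℝ^{nr} with (ℝ^r)^n. -/
theorem exists_adaptedCoframe [IsManifold (𝓡 (n * r)) ∞ X] (hn : 2 ≤ n) (W : Web n r X) (q : X) :
    ∃ (S : W.AdaptedCoframe) (θ : Fin r → Fin r → Vec (n * r) → Vec (n * r) →L[ℝ] ℝ)
      (t : Fin n → Fin n → Fin r → Fin r → Fin r → Vec (n * r) → ℝ),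
      q ∈ S.chart.source ∧ S.StructureEquations θ t := by
  obtain ⟨C, hq⟩ := W.exists_closedForm q
  obtain ⟨Φ, hΦ, hqΦ, hΦU, hval, hd⟩ := exists_coord_chart C.isOpen C.smooth C.ker_eq hq
  let L : Vec (n * r) →L[ℝ] (Fin n → Vec r) := (coordEquiv n r).symm.toContinuousLinearMap
  have hL : ∀ p ∈ Φ.source, L (Φ p) = coordMap C.x p := fun p hp => by
    rw [hval p hp]
    exact (coordEquiv n r).symm_apply_apply _
  have hLd : ∀ p ∈ Φ.source, ∀ v, L (mfderiv (𝓡 (n * r)) (𝓡 (n * r)) Φ p v) = dcoord C.x p v :=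
    fun p hp v => by
      rw [hd p hp]
      exact (coordEquiv n r).symm_apply_apply _
  let Ω : Set (Fin n → Vec r) := coordMap C.x '' C.U
  have hLΩ : ∀ y ∈ Φ.target, L y ∈ Ω := fun y hy =>
    ⟨Φ.symm y, hΦU (Φ.map_target hy), by rw [← hL _ (Φ.map_target hy), Φ.right_inv hy]⟩
  have hinj : ∀ w ∈ Ω, PartialsInjective C.f w := by
    rintro _ ⟨p, hp, rfl⟩
    exact C.partialsInjective hp
  obtain ⟨θ, t, hθ, ht, hst⟩ := exists_structureAt hn C.isOpen_image_coordMap C.contDiffOn_f hinj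
  let η : Fin n → (Fin n → Vec r) → (Fin n → Vec r) →L[ℝ] Vec r := fun α w =>
    (partialDeriv C.f α w) ∘L ContinuousLinearMap.proj α
  have hη : ∀ α, ContDiffOn ℝ ∞ (η α) Ω := by
    intro α w hw
    have h1 := C.contDiffOn_f.contDiffAt (C.isOpen_image_coordMap.mem_nhds hw)
    exact (((h1.fderiv_right (m := ∞) (by simp)).clm_comp contDiffAt_const).clm_comp
      contDiffAt_const).contDiffWithinAt
  have hLs : ContDiffOn ℝ ∞ L Φ.target := L.contDiff.contDiffOn
  let S : W.AdaptedCoframe := {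
    chart := Φ
    chart_mem := hΦ
    coordForm := fun α y => (η α (L y)) ∘L L
    smooth := fun α => ((hη α).comp hLs hLΩ).clm_comp contDiffOn_const
    ker_eq := by
      intro p hp α v
      rw [C.mem_tangent_iff (hΦU hp)]
      change _ ↔ η α (L (Φ p)) (L (mfderiv (𝓡 (n * r)) (𝓡 (n * r)) Φ p v)) = 0
      rw [hL p hp, hLd p hp]
      exact (map_eq_zero_iff (partialDeriv C.f α (coordMap C.x p))
        (C.partialsInjective (hΦU hp) α)).symm
    ker_last_eq := by
      intro p hp v
      rw [C.mem_tangent_last_iff (hΦU hp), ← sum_fderiv_single]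
      change _ ↔ ∑ α, η α (L (Φ p)) (L (mfderiv (𝓡 (n * r)) (𝓡 (n * r)) Φ p v)) = 0
      rw [hL p hp, hLd p hp]
      rfl }
  refine ⟨S, fun i j y => (θ i j (L y)) ∘L L, fun α β i j m y => t α β i j m (L y), hqΦ, ?_⟩
  refine
    { smooth_conn := fun i j => ((hθ i j).comp hLs hLΩ).clm_comp contDiffOn_const
      smooth_torsion := fun α β i j m _ => (ht α β i j m).comp hLs hLΩ
      structure_eq := ?_
      torsion_symm := fun y hy α β i j m _ => (hst _ (hLΩ y hy)).2.1 α β i j m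
      torsion_sum := fun y hy i j m => (hst _ (hLΩ y hy)).2.2 i j m }
  intro y hy α i u v
  have h1 : dForm (S.coordForm α) y u v = dForm (η α) (L y) (L u) (L v) := by
    have h2 := dForm_pullback (χ := L) (η := η α) (y := y) L.contDiff.contDiffAt
      (((hη α).contDiffAt (C.isOpen_image_coordMap.mem_nhds (hLΩ y hy))).differentiableAt
        (by simp)) u v
    simpa only [ContinuousLinearMap.fderiv] using h2
  rw [h1]
  exact (hst _ (hLΩ y hy)).1 α i (L u) (L v)

end Web

/-! ### The equivalence -/

theorem mainTheorem1 {n r l k : ℕ} (hl : 1 ≤ l) (hlk : l < k) (hkn : k < n)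
    {X : Type*} [TopologicalSpace X] [ChartedSpace (Vec (n * r)) X]
    [IsManifold (𝓡 (n * r)) ∞ X] (W : Web n r X) :
    -- adapted coframes with their structure equations, and closed form equations, exist locally
    (∀ q : X, ∃ (S : W.AdaptedCoframe)
      (θ : Fin r → Fin r → Vec (n * r) → Vec (n * r) →L[ℝ] ℝ)
      (t : Fin n → Fin n → Fin r → Fin r → Fin r → Vec (n * r) → ℝ),
      q ∈ S.chart.source ∧ S.StructureEquations θ t) ∧
    (∀ q : X, ∃ C : W.ClosedForm, q ∈ C.U) ∧
    List.TFAE [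
      W.HasReducibleReduct l k hkn,
      W.TorsionCondition l k,
      W.DistributionIntegrable l k,
      W.HasReductClosedForm l k] := by
  refine ⟨W.exists_adaptedCoframe (by omega), W.exists_closedForm, ?_⟩
  -- The condition through which the implications pass; it is imposed at every point of every closed
  -- form equation.
  let Inf : Prop := ∀ (C : W.ClosedForm), ∀ q ∈ C.U, InfReducible l k C.f (coordMap C.x q)
  have h1 : W.HasReducibleReduct l k hkn → Inf := fun h C q hq =>
    infReducible_of_reducibleNear hlk hkn.le (C.smoothNear_f hq) (C.partialsInjective hq) (h C q hq)
  have h2 : W.TorsionCondition l k ↔ Inf := by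
    constructor
    · intro h C q hq
      obtain ⟨S, θ, t, hS, hst⟩ := W.exists_adaptedCoframe (by omega) q
      exact (S.torsion_eq_iff C hl hlk hkn hS hq hst).1 (h S θ t hst _ (S.chart.map_source hS))
    · intro h S θ t hst y hy
      have hS := S.chart.map_target hy
      obtain ⟨C, hC⟩ := W.exists_closedForm (S.chart.symm y)
      have := (S.torsion_eq_iff C hl hlk hkn hS hC hst).2 (h C _ hC)
      rwa [S.chart.right_inv hy] at this
  have h3 : W.DistributionIntegrable l k → Inf := by
    intro h C q hq
    obtain ⟨S, -, -, hS, -⟩ := W.exists_adaptedCoframe (by omega) q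
    obtain ⟨U, u, hU, hqU, hu, hd⟩ := h S q hS
    obtain ⟨κ, O, hO, hqO, hκq, hκ, hκO⟩ := C.exists_local_section hq
    let O' : Set (Fin n → Vec r) := O ∩ κ ⁻¹' (S.chart.source ∩ U)
    have hO' : IsOpen O' :=
      hκ.continuousOn.isOpen_inter_preimage hO (S.chart.open_source.inter hU)
    have hqO' : coordMap C.x q ∈ O' := ⟨hqO, by
      change κ (coordMap C.x q) ∈ S.chart.source ∩ U
      rw [hκq]
      exact ⟨hS, hqU⟩⟩
    -- Read in web coordinates, the submersion has the vectors of the reduct distribution as its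
    -- kernel.
    have hs : ContDiffOn ℝ ∞ (fun w => u (κ w)) O' := contMDiffOn_iff_contDiffOn.1
      (hu.comp (hκ.mono Set.inter_subset_left) fun w hw => hw.2.2)
    refine infReducible_of_reductVectors hlk (u := fun w => u (κ w)) (C.contDiffAt_f hq) ?_ ?_
    · filter_upwards [hO'.mem_nhds hqO'] with w hw
      exact (hs.contDiffAt (hO'.mem_nhds hw)).differentiableAt (by simp)
    · filter_upwards [hO'.mem_nhds hqO'] with w hw v
      obtain ⟨hwU, hcw, hdw⟩ := hκO w hw.1
      have e1 : MDifferentiableAt 𝓘(ℝ, Fin n → Vec r) (𝓡 (n * r)) κ w :=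
        (hκ.contMDiffAt (hO.mem_nhds hw.1)).mdifferentiableAt (by simp)
      have e2 : MDifferentiableAt (𝓡 (n * r)) (𝓡 ((n - k + 1) * r)) u (κ w) :=
        (hu.contMDiffAt (hU.mem_nhds hw.2.2)).mdifferentiableAt (by simp)
      have e3 := mfderiv_comp w e2 e1
      rw [mfderiv_eq_fderiv] at e3
      have e4 := S.mem_distribution_iff C (by omega) (l := l) (k := k) hw.2.1 hwU
        (mfderiv 𝓘(ℝ, Fin n → Vec r) (𝓡 (n * r)) κ w v)
      rw [(hd _ hw.2.2).2, hdw, hcw] at e4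
      have e5 : fderiv ℝ (fun w => u (κ w)) w v = mfderiv (𝓡 (n * r)) (𝓡 ((n - k + 1) * r)) u (κ w)
        (mfderiv 𝓘(ℝ, Fin n → Vec r) (𝓡 (n * r)) κ w v) := DFunLike.congr_fun e3 v
      rw [e5]
      exact e4
  have h4 : Inf → W.HasReductClosedForm l k := fun h C q hq =>
    reductFormNear_of_infReducible hlk hkn (C.eventually_coordMap hq fun p hp =>
      ⟨C.contDiffAt_f hp, C.partialsInjective hp, h C p hp⟩)
  have h5 : W.HasReductClosedForm l k → W.HasReducibleReduct l k hkn := fun h C q hq =>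
    reducibleNear_of_reductFormNear hkn.le (h C q hq)
  have h6 : W.HasReductClosedForm l k → W.DistributionIntegrable l k := by
    intro h S q hS
    obtain ⟨C, hC⟩ := W.exists_closedForm q
    obtain ⟨u, O, hO, hqO, hu, hd⟩ := exists_submersion_of_reductFormNear hlk hkn
      (C.eventually_partialsInjective hC) (h C q hC)
    have hc := contMDiffOn_coordMap C.smooth
    refine ⟨(C.U ∩ coordMap C.x ⁻¹' O) ∩ S.chart.source, fun p => u (coordMap C.x p),
      (hc.continuousOn.isOpen_inter_preimage C.isOpen hO).inter S.chart.open_source,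
      ⟨⟨hC, hqO⟩, hS⟩, ?_, ?_⟩
    · exact (contMDiffOn_iff_contDiffOn.2 hu).comp (hc.mono fun p hp => hp.1.1)
        fun p hp => hp.1.2
    · rintro p ⟨⟨hpU, hpO⟩, hpS⟩
      have hud : DifferentiableAt ℝ u (coordMap C.x p) :=
        (hu.contDiffAt (hO.mem_nhds hpO)).differentiableAt (by simp)
      have hm := C.mfderiv_comp_coordMap hpU hud
      constructor
      · intro y
        obtain ⟨w, hw⟩ := (hd _ hpO).1 y
        obtain ⟨v, rfl⟩ := (C.bijective_dcoord hpU).2 w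
        exact ⟨v, (hm v).trans hw⟩
      · ext v
        rw [S.mem_distribution_iff C (by omega) hpS hpU, ← (hd _ hpO).2, ← hm]
        rfl
  tfae_have 1 → 2 := fun h => h2.2 (h1 h)
  tfae_have 2 → 4 := fun h => h4 (h2.1 h)
  tfae_have 4 → 1 := h5
  tfae_have 4 → 3 := h6
  tfae_have 3 → 2 := fun h => h2.2 (h3 h)
  tfae_finish
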